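/- A matrix $\Phi\in\mathbb C^{n\times N}$ satisfies the RIP of order $k$ with parameter $\delta$ if $(1-\delta)\|x\|^2\le\|\Phi x\|^2\le(1+\delta)\|x\|^2$ for every $x\in\mathbb C^N$ with at most $k$ nonzero coordinates. For a set $T$ of columns let $\Phi_T$ be the corresponding submatrix and $\delta_T=\sup_{x\ne0}\bigl|\,\|\Phi_Tx\|^2/\|x\|^2-1\bigr|$. For $2\le m\le N$ and $\delta\in(0,1)$, the lazy algorithm determines the RIP parameter of order $m$, $\varepsilon=\max_{|T|=m}\delta_T$, by enumerating the $m$-subsets $T$ of the columns, and certifies every order $k\ge m$ such that $\varepsilon(k-1)/(m-1)\le\delta$. It is implemented on real matrices, in unit-cost real arithmetic, as follows: for each $k\in\{m,\dots,N\}$ it enumerates the $m$-subsets $T$ of columns and tests $\delta_T\le\delta(m-1)/(k-1)$ by symmetric Gaussian elimination, and it outputs the list of those $k$ for which all tests succeed. By $A$ we denote an $n\times N$ random matrix with independent entries that are $\pm1$ with probability $1/2$ each, and we set $\Phi=A/\sqrt n$. All logarithms are natural. (0) The algorithm is correct: if $\Phi\in\mathbb C^{n\times N}$ has unit columns and the lazy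 algorithm with inputs $m,\delta$ ($2\le m\le N$, $0<\delta<1$) certifies the order $k$, then $\Phi$ satisfies the RIP of order $k$ with parameter $\delta$. For every real $\Phi$ the implementation outputs exactly the certified orders $k\le N$. (1) There are absolute constants $c,C>0$ such that: (a) whenever $1\le m\le N$, $0<\varepsilon<1$ and $n\ge C\varepsilon^{-2}m\log(eN/m)$, with probability at least $1-2\exp(-c\varepsilon^2n)$ the matrix $A/\sqrt n$ satisfies the RIP of order $m$ with parameter $\varepsilon$; (b) with the same $c,C$, whenever $2\le m\le N$ and $0<\delta<1$, with probability at least $1-2(eN/m)^{-cCm}$ the lazy algorithm certifies that $A/\sqrt n$ satisfies the RIP of order $k$ with parameter $\delta$, simultaneously for all integers $k\ge m$ with $$k\le\delta\sqrt{\frac{mn}{C\log(eN/m)}}.$$ (2) There are absolute constants $K,\kappa,L>0$ such that for $m=\lfloor(\log N)^3\rfloor$, whenever $2\le m\le N$ and $0<\delta<1$: the implementation makes at most $2^{L(\log N)^4}$ steps on every real $n\times N$ matrix with $n\le N$; and, for every $n$, with probability at least $1-2^{-\kappa(\log N)^4}$ the lazy algorithm certifies that $A/\sqrt n$ satisfies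 the RIP of order $k$ with parameter $\delta$, simultaneously for all integers $k\ge m$ with $k\le K\delta\log N\,\sqrt n$. -/

import Mathlib

open MeasureTheory ProbabilityTheory

noncomputable section

namespace LazyRIP

/-! ### The restricted isometry property -/

/-- `x ∈ ℂ^N` has at most `k` nonzero coordinates. -/
def IsSparse {N : ℕ} (k : ℕ) (x : EuclideanSpace ℂ (Fin N)) : Prop :=
  {i : Fin N | x i ≠ 0}.ncard ≤ k

/-- The restricted isometry property of order `k` with parameter `δ`. -/
def HasRIP {n N : ℕ} (Φ : Matrix (Fin n) (Fin N) ℂ) (k : ℕ) (δ : ℝ) : Prop :=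
  ∀ x : EuclideanSpace ℂ (Fin N), IsSparse k x →
    (1 - δ) * ‖x‖ ^ 2 ≤ ‖Matrix.toEuclideanLin Φ x‖ ^ 2 ∧
      ‖Matrix.toEuclideanLin Φ x‖ ^ 2 ≤ (1 + δ) * ‖x‖ ^ 2

/-- All columns have Euclidean norm one. -/
def UnitColumns {n N : ℕ} (Φ : Matrix (Fin n) (Fin N) ℂ) : Prop :=
  ∀ j, ∑ i, ‖Φ i j‖ ^ 2 = 1

/-- `δ_T = sup_{x ≠ 0} | ‖Φ_T x‖² / ‖x‖² - 1 |`, where `Φ_T` consists of the columns of `Φ` whose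
index lies in `T`. -/
def subsetParameter {n N : ℕ} (Φ : Matrix (Fin n) (Fin N) ℂ) (T : Finset (Fin N)) : ℝ :=
  ⨆ x : {x : EuclideanSpace ℂ T // x ≠ 0},
    |‖Matrix.toEuclideanLin (Φ.submatrix id (fun i : T => (i : Fin N))) x.1‖ ^ 2 / ‖x.1‖ ^ 2 - 1|

/-- The RIP parameter of order `m`: the maximum of `δ_T` over the `m`-subsets `T` of the columns. -/
def ripParameter {n N : ℕ} (Φ : Matrix (Fin n) (Fin N) ℂ) (m : ℕ) : ℝ :=
  ⨆ T : {T : Finset (Fin N) // T.card = m}, subsetParameter Φ T.1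

/-- The certification rule of the lazy algorithm: on input `Φ`, `m`, `δ`, with `ε` the RIP parameter
of order `m` of `Φ`, it certifies every order `k ≥ m` such that `ε (k - 1) / (m - 1) ≤ δ`. -/
def LazyCertifies {n N : ℕ} (Φ : Matrix (Fin n) (Fin N) ℂ) (m : ℕ) (δ : ℝ) (k : ℕ) : Prop :=
  m ≤ k ∧ ripParameter Φ m * ((k : ℝ) - 1) / ((m : ℝ) - 1) ≤ δ

/-! ### Random sign matrices -/

/-- The entries of `A` are independent symmetric Bernoulli (`±1`) random variables. -/
structure IsSymmetricBernoulli {Ω : Type*} [MeasurableSpace Ω] (μ : Measure Ω) {n N : ℕ}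
    (A : Ω → Matrix (Fin n) (Fin N) ℝ) : Prop where
  measurable : ∀ i j, Measurable fun ω => A ω i j
  prob_one : ∀ i j, μ {ω | A ω i j = 1} = 1 / 2
  prob_neg_one : ∀ i j, μ {ω | A ω i j = -1} = 1 / 2
  indep : iIndepFun (fun (p : Fin n × Fin N) ω => A ω p.1 p.2) μ

/-- The normalized matrix `A / √n`, seen as a complex matrix. -/
def normalized {n N : ℕ} (A : Matrix (Fin n) (Fin N) ℝ) : Matrix (Fin n) (Fin N) ℂ :=
  A.map fun a => ((a / Real.sqrt n : ℝ) : ℂ)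

/-! ### Step-counted computations over the reals

Unit-cost real arithmetic: every field operation and every comparison (of stored numbers), every
reading or storing of a matrix entry and every elementary control step costs one unit. A computation
pays for all its parts. -/

/-- A value together with the number of steps spent on computing it. -/
structure Timed (α : Type) where
  val : α
  time : ℕ

/-- Sequential composition adds up the numbers of steps. -/
instance : Monad Timed where
  pure a := ⟨a, 0⟩
  bind x f := ⟨(f x.val).val, x.time + (f x.val).time⟩

/-- One elementary step (reading a stored number, returning a result). -/
def step {α : Type} (a : α) : Timed α := ⟨a, 1⟩

def add (x y : ℝ) : Timed ℝ := ⟨x + y, 1⟩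

def sub (x y : ℝ) : Timed ℝ := ⟨x - y, 1⟩

def mul (x y : ℝ) : Timed ℝ := ⟨x * y, 1⟩

def div (x y : ℝ) : Timed ℝ := ⟨x / y, 1⟩

open Classical in
/-- The comparison `x < y`. -/
def lt (x y : ℝ) : Timed Bool := ⟨decide (x < y), 1⟩

open Classical in
/-- The comparison `x = y`. -/
def eq (x y : ℝ) : Timed Bool := ⟨decide (x = y), 1⟩

/-- Reading the `i`-th element of a linked list. -/
def fetch {α : Type} (l : List α) (i : Fin l.length) : Timed α := ⟨l.get i, i.val + 1⟩

/-- Computing a `d × d` array entry by entry; storing an entry costs one step. -/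
def tabulate {d : ℕ} (f : Fin d → Fin d → Timed ℝ) : Timed (Matrix (Fin d) (Fin d) ℝ) :=
  ⟨fun i j => (f i j).val, ∑ i, ∑ j, ((f i j).time + 1)⟩

/-- Adding up the values `f i` along a list. -/
def sumLoop {ι : Type} (f : ι → Timed ℝ) : List ι → Timed ℝ
  | [] => step 0
  | i :: l => do
    let x ← f i
    let s ← sumLoop f l
    add x s

/-- Checking a test along a list. -/
def allLoop {ι : Type} (f : ι → Timed Bool) : List ι → Timed Bool
  | [] => step true
  | i :: l => do
    let b ← f i
    if b then allLoop f l else step false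

/-- Listing the elements that pass a test. -/
def filterLoop {ι : Type} (f : ι → Timed Bool) : List ι → Timed (List ι)
  | [] => step []
  | i :: l => do
    let b ← f i
    let r ← filterLoop f l
    if b then step (i :: r) else step r

/-- Symmetric Gaussian elimination, deciding whether a symmetric matrix is positive semidefinite. -/
def psdTest : (d : ℕ) → Matrix (Fin d) (Fin d) ℝ → Timed Bool
  | 0, _ => step true
  | d + 1, M => do
    let neg ← lt (M 0 0) 0
    if neg then step false
    else do
      let zero ← eq (M 0 0) 0
      if zero then do
        let rowZero ← allLoop (fun j : Fin d => eq (M 0 j.succ) 0) (List.finRange d)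
        if rowZero then do
          let M' ← tabulate fun i j => step (M i.succ j.succ)
          psdTest d M'
        else step false
      else do
        let M' ← tabulate fun i j => do
          let q ← mul (M i.succ 0) (M 0 j.succ)
          let r ← div q (M 0 0)
          sub (M i.succ j.succ) r
        psdTest d M'

/-- The test `δ_T ≤ t`, where `T` is the set of the columns listed in `cols`: the matrices
`(1 + t) I - Φ_Tᵀ Φ_T` and `Φ_Tᵀ Φ_T - (1 - t) I` both have to be positive semidefinite. -/
def subsetTest {n N : ℕ} (Φ : Matrix (Fin n) (Fin N) ℝ) (t : ℝ) (cols : List (Fin N)) :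
    Timed Bool := do
  let G ← tabulate fun i j : Fin cols.length => do
    let p ← fetch cols i
    let q ← fetch cols j
    sumLoop (fun r => do
      let x ← step (Φ r p)
      let y ← step (Φ r q)
      mul x y) (List.finRange n)
  let U ← tabulate fun i j : Fin cols.length => do
    let c ← if i = j then add 1 t else step 0
    sub c (G i j)
  let L ← tabulate fun i j : Fin cols.length => do
    let c ← if i = j then sub 1 t else step 0
    sub (G i j) c
  let u ← psdTest _ U
  let l ← psdTest _ L
  step (u && l)

/-- Runs `test` on `S ∪ chosen` for all `m`-subsets `S` of the given list, by the recursion on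
whether the first element of the list is taken; the answer is `true` if all the tests succeed. -/
def allSubsets {α : Type} (test : List α → Timed Bool) : ℕ → List α → List α → Timed Bool
  | 0, _, chosen => test chosen
  | _ + 1, [], _ => step true
  | m + 1, a :: l, chosen => do
    let b₁ ← allSubsets test m l (a :: chosen)
    let b₂ ← allSubsets test (m + 1) l chosen
    step (b₁ && b₂)

/-- The lazy algorithm as a step-counted program. It lists the orders `k ∈ {m, …, N}` that it
certifies: those for which every `m`-subset `T` of the columns satisfies
`δ_T ≤ δ (m - 1) / (k - 1)`. -/
def lazyProgram {n N : ℕ} (Φ : Matrix (Fin n) (Fin N) ℝ) (m : ℕ) (δ : ℝ) : Timed (List ℕ) :=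
  filterLoop (fun k => do
    let x ← sub (m : ℝ) 1
    let y ← mul δ x
    let z ← sub (k : ℝ) 1
    let t ← div y z
    allSubsets (subsetTest Φ t) m (List.finRange N) []) (List.range' m (N + 1 - m))

end LazyRIP

end

/-! Correctness rests on averaging. Put q(x) = ‖Φx‖² - ‖x‖² and let x be supported in a set S of s ≥
3 columns. Deleting one coordinate of x at a time and summing the values of q gives (s - 2) q(x),
because unit columns make q vanish on each single coordinate; the squared norms sum to (s - 1)‖x‖².
So the isometry constant grows by at most (s - 1)/(s - 2) from size s - 1 to s
(`IsometryOn.of_erase`), and these factors telescope to (k - 1)/(m - 1), the ratio in the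
certification rule.

The program is exact because δ_T ≤ t amounts to positive semidefiniteness of two real symmetric
matrices, which elimination decides through Schur complements (`psdTest_val`); complex vectors split
into real and imaginary parts (`isometryOn_map_iff`).

For sign matrices, each coordinate Q of Ax with ‖x‖ = 1 is sub-Gaussian with parameter 1 and has
second moment 1. Hence Q² - 1 has moment generating function at most exp(2048 l²) near 0
(`mgf_sq_sub_one_le`), and a Chernoff bound over the independent rows controls ‖Ax‖²/n - 1 for a
fixed x. A quarter-net of at most 9^m unit vectors for each m-subset (`exists_quarter_net`), a union
bound, and a polarization argument from net to sphere (`abs_norm_sq_sub_norm_sq_le_of_net`) give the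
RIP of order m. Taking the smallest ε that n allows turns this into the range of certified k
(`measureReal_lazyCertifies_ge`).

The running time is a polynomial cost per subset times a number of recursive calls bounded by (N +
1)^m (`allSubsets_time_le`). For m = ⌊(log N)³⌋ both this and the failure probability are governed
by m log N, of order (log N)⁴. -/

noncomputable section

namespace LazyRIP

variable {n N : ℕ}

/-! ### The restricted isometry constants as quadratic inequalities -/

/-- The form `‖Φ x‖² - ‖x‖²` is bounded by `t ‖x‖²` on the vectors supported in `T`. -/
def IsometryOn (Φ : Matrix (Fin n) (Fin N) ℂ) (T : Finset (Fin N)) (t : ℝ) : Prop :=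
  ∀ x : EuclideanSpace ℂ (Fin N), (∀ i ∉ T, x i = 0) →
    |‖Matrix.toEuclideanLin Φ x‖ ^ 2 - ‖x‖ ^ 2| ≤ t * ‖x‖ ^ 2

/-- Extension of a vector by zero. -/
def extendZero (T : Finset (Fin N)) (y : EuclideanSpace ℂ T) : EuclideanSpace ℂ (Fin N) :=
  WithLp.toLp 2 fun i => if h : i ∈ T then y ⟨i, h⟩ else 0

lemma extendZero_apply_of_notMem {T : Finset (Fin N)} (y : EuclideanSpace ℂ T) {i : Fin N}
    (hi : i ∉ T) : extendZero T y i = 0 := by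
  simp [extendZero, hi]

lemma extendZero_coe {T : Finset (Fin N)} (y : EuclideanSpace ℂ T) (i : T) :
    extendZero T y i = y i := by
  simp [extendZero]

lemma sum_of_support_subset {M : Type*} [AddCommMonoid M] {T : Finset (Fin N)} {f : Fin N → M}
    (h : ∀ i ∉ T, f i = 0) : ∑ i, f i = ∑ i : T, f i := by
  rw [Finset.sum_coe_sort T f]
  exact (Finset.sum_subset (Finset.subset_univ _) fun i _ hi => h i hi).symm

lemma norm_extendZero {T : Finset (Fin N)} (y : EuclideanSpace ℂ T) :
    ‖extendZero T y‖ = ‖y‖ := by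
  rw [EuclideanSpace.norm_eq, EuclideanSpace.norm_eq,
    sum_of_support_subset (T := T) fun i hi => by simp [extendZero_apply_of_notMem y hi]]
  simp only [extendZero_coe]

lemma toEuclideanLin_extendZero (Φ : Matrix (Fin n) (Fin N) ℂ) {T : Finset (Fin N)}
    (y : EuclideanSpace ℂ T) :
    Matrix.toEuclideanLin Φ (extendZero T y) =
      Matrix.toEuclideanLin (Φ.submatrix id (fun i : T => (i : Fin N))) y := by
  ext r
  simp only [Matrix.toLpLin_apply, Matrix.mulVec, dotProduct]
  rw [sum_of_support_subset (T := T) fun i hi => by simp [extendZero_apply_of_notMem y hi]]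
  simp [extendZero_coe]

lemma bddAbove_subsetParameter (Φ : Matrix (Fin n) (Fin N) ℂ) (T : Finset (Fin N)) :
    BddAbove (Set.range fun x : {x : EuclideanSpace ℂ T // x ≠ 0} =>
      |‖Matrix.toEuclideanLin (Φ.submatrix id (fun i : T => (i : Fin N))) x.1‖ ^ 2 / ‖x.1‖ ^ 2
        - 1|) := by
  let L := LinearMap.toContinuousLinearMap
    (Matrix.toEuclideanLin (Φ.submatrix id (fun i : T => (i : Fin N))))
  refine ⟨‖L‖ ^ 2 + 1, ?_⟩
  rintro _ ⟨⟨x, hx⟩, rfl⟩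
  have hx' : 0 < ‖x‖ := norm_pos_iff.2 hx
  have h : ‖L x‖ ^ 2 / ‖x‖ ^ 2 ≤ ‖L‖ ^ 2 := by
    rw [div_le_iff₀ (by positivity), ← mul_pow]
    exact pow_le_pow_left₀ (norm_nonneg _) (L.le_opNorm x) 2
  have h0 : 0 ≤ ‖L x‖ ^ 2 / ‖x‖ ^ 2 := by positivity
  change |‖L x‖ ^ 2 / ‖x‖ ^ 2 - 1| ≤ _
  rw [abs_le]
  constructor <;> nlinarith [sq_nonneg ‖L‖]

lemma subsetParameter_nonneg (Φ : Matrix (Fin n) (Fin N) ℂ) (T : Finset (Fin N)) :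
    0 ≤ subsetParameter Φ T :=
  Real.iSup_nonneg fun _ => abs_nonneg _

lemma ripParameter_nonneg (Φ : Matrix (Fin n) (Fin N) ℂ) (m : ℕ) : 0 ≤ ripParameter Φ m :=
  Real.iSup_nonneg fun _ => subsetParameter_nonneg _ _

lemma abs_div_sub_one_le_iff {a b t : ℝ} (hb : 0 < b) : |a / b - 1| ≤ t ↔ |a - b| ≤ t * b := by
  rw [div_sub_one hb.ne', abs_div, abs_of_pos hb, div_le_iff₀ hb]

/-- Nonnegativity of t covers T = ∅, where the supremum runs over an empty type and equals 0. -/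
lemma subsetParameter_le_iff {Φ : Matrix (Fin n) (Fin N) ℂ} {T : Finset (Fin N)} {t : ℝ}
    (ht : 0 ≤ t) : subsetParameter Φ T ≤ t ↔ IsometryOn Φ T t := by
  constructor
  · intro h x hx
    let y : EuclideanSpace ℂ T := WithLp.toLp 2 fun i => x i
    have hxy : extendZero T y = x := by
      ext i
      by_cases hi : i ∈ T
      · simp [extendZero, y, hi]
      · rw [extendZero_apply_of_notMem _ hi, hx i hi]
    by_cases hy : y = 0
    · have : x = 0 := by
        rw [← hxy, hy]
        ext i
        simp [extendZero]
      simp [this]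
    · rw [← hxy, toEuclideanLin_extendZero, norm_extendZero]
      have hy' : 0 < ‖y‖ ^ 2 := by have := norm_pos_iff.2 hy; positivity
      rw [← abs_div_sub_one_le_iff hy']
      exact (le_ciSup (bddAbove_subsetParameter Φ T) ⟨y, hy⟩).trans h
  · intro h
    refine Real.iSup_le (fun ⟨y, hy⟩ => ?_) ht
    have hy' : 0 < ‖y‖ ^ 2 := by have := norm_pos_iff.2 hy; positivity
    rw [abs_div_sub_one_le_iff hy']
    have := h (extendZero T y) fun i hi => extendZero_apply_of_notMem y hi
    rwa [toEuclideanLin_extendZero, norm_extendZero] at this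

lemma ripParameter_le_iff {Φ : Matrix (Fin n) (Fin N) ℂ} {m : ℕ} {t : ℝ} (ht : 0 ≤ t) :
    ripParameter Φ m ≤ t ↔ ∀ T : Finset (Fin N), T.card = m → IsometryOn Φ T t := by
  constructor
  · intro h T hT
    rw [← subsetParameter_le_iff ht]
    exact (le_ciSup (f := fun T : {T : Finset (Fin N) // T.card = m} => subsetParameter Φ T.1)
      (Set.finite_range _).bddAbove ⟨T, hT⟩).trans h
  · intro h
    exact Real.iSup_le (fun T => (subsetParameter_le_iff ht).2 (h T.1 T.2)) ht

lemma hasRIP_iff {Φ : Matrix (Fin n) (Fin N) ℂ} {k : ℕ} {δ : ℝ} :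
    HasRIP Φ k δ ↔ ∀ x : EuclideanSpace ℂ (Fin N), IsSparse k x →
      |‖Matrix.toEuclideanLin Φ x‖ ^ 2 - ‖x‖ ^ 2| ≤ δ * ‖x‖ ^ 2 := by
  refine forall₂_congr fun x _ => ?_
  rw [abs_le]
  constructor <;> rintro ⟨h₁, h₂⟩ <;> constructor <;> linarith

lemma IsometryOn.mono {Φ : Matrix (Fin n) (Fin N) ℂ} {S T : Finset (Fin N)} {s t : ℝ}
    (h : IsometryOn Φ T s) (hST : S ⊆ T) (hst : s ≤ t) : IsometryOn Φ S t := fun x hx =>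
  (h x fun i hi => hx i fun hi' => hi (hST hi')).trans (by gcongr)

lemma hasRIP_iff_isometryOn {Φ : Matrix (Fin n) (Fin N) ℂ} {k : ℕ} {δ : ℝ} :
    HasRIP Φ k δ ↔ ∀ T : Finset (Fin N), T.card ≤ k → IsometryOn Φ T δ := by
  classical
  rw [hasRIP_iff]
  constructor
  · intro h T hT x hx
    refine h x ?_
    have : {i : Fin N | x i ≠ 0} ⊆ (T : Set (Fin N)) := by
      intro i hi
      by_contra hi'
      exact hi (hx i hi')
    exact (Set.ncard_le_ncard this T.finite_toSet).trans (by simpa using hT)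
  · intro h x hx
    refine h (Finset.univ.filter fun i => x i ≠ 0) ?_ x fun i hi => by simpa using hi
    rw [IsSparse, Set.ncard_eq_toFinset_card'] at hx
    convert hx using 2
    ext i
    simp

lemma hasRIP_of_card_eq {Φ : Matrix (Fin n) (Fin N) ℂ} {m : ℕ} {δ : ℝ} (hm : m ≤ N)
    (h : ∀ T : Finset (Fin N), T.card = m → IsometryOn Φ T δ) : HasRIP Φ m δ := by
  refine hasRIP_iff_isometryOn.2 fun S hS => ?_
  obtain ⟨T, hST, hT⟩ := Finset.exists_superset_card_eq hS (by simpa using hm)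
  exact (h T hT).mono hST le_rfl

/-! ### From order `m` to higher orders -/

section erase

variable {E : Type*} [NormedAddCommGroup E] [InnerProductSpace ℂ E]

/-- Expanding the squares, the cross terms add up to 2‖v‖², where v is the full sum. The identity is
used once for the coordinate parts of x and once for their images under Φ; subtracting cancels the
last sums. -/
lemma sum_norm_sub_sq (S : Finset (Fin N)) (w : Fin N → E) :
    ∑ i ∈ S, ‖∑ j ∈ S, w j - w i‖ ^ 2 =
      ((S.card : ℝ) - 2) * ‖∑ j ∈ S, w j‖ ^ 2 + ∑ i ∈ S, ‖w i‖ ^ 2 := by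
  set v := ∑ j ∈ S, w j with hv
  have h : ∑ i ∈ S, RCLike.re (inner ℂ v (w i)) = ‖v‖ ^ 2 := by
    rw [← map_sum, ← inner_sum, ← hv, inner_self_eq_norm_sq]
  simp only [norm_sub_sq (𝕜 := ℂ), Finset.sum_add_distrib, Finset.sum_sub_distrib, ← Finset.mul_sum,
    h, Finset.sum_const, nsmul_eq_mul]
  ring

end erase

/-- The averaging step: q(x) is the sum of q(x - x_i e_i) over i in S, divided by |S| - 2. -/
lemma IsometryOn.of_erase {Φ : Matrix (Fin n) (Fin N) ℂ} (hΦ : UnitColumns Φ)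
    {S : Finset (Fin N)} {t : ℝ} (hS : 3 ≤ S.card)
    (h : ∀ i ∈ S, IsometryOn Φ (S.erase i) t) :
    IsometryOn Φ S (t * ((S.card : ℝ) - 1) / ((S.card : ℝ) - 2)) := by
  intro x hx
  have hS' : (3 : ℝ) ≤ S.card := by exact_mod_cast hS
  let e : Fin N → EuclideanSpace ℂ (Fin N) := fun i => EuclideanSpace.single i (x i)
  have he : ∑ i ∈ S, e i = x := by
    ext j
    by_cases hj : j ∈ S
    · simp [e, hj, Pi.single_apply]
    · simp [e, hj, Pi.single_apply, hx j hj]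
  have hne : ∑ i ∈ S, ‖e i‖ ^ 2 = ‖x‖ ^ 2 := by
    simp only [e, PiLp.norm_single]
    rw [EuclideanSpace.norm_sq_eq]
    exact Finset.sum_subset (Finset.subset_univ _) fun i _ hi => by simp [hx i hi]
  -- The only place where unit columns enter: the diagonal terms of q vanish.
  have hL : ∀ i, ‖Matrix.toEuclideanLin Φ (e i)‖ ^ 2 = ‖e i‖ ^ 2 := by
    intro i
    rw [EuclideanSpace.norm_sq_eq]
    simp only [e, PiLp.norm_single, Matrix.toLpLin_apply]
    calc ∑ r, ‖(Φ.mulVec (Pi.single i (x i))) r‖ ^ 2 = ∑ r, ‖Φ r i‖ ^ 2 * ‖x i‖ ^ 2 := by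
          simp [mul_pow]
      _ = _ := by rw [← Finset.sum_mul, hΦ i, one_mul]
  have key₁ := sum_norm_sub_sq S e
  have key₂ := sum_norm_sub_sq S fun i => Matrix.toEuclideanLin Φ (e i)
  simp only [← map_sum, ← map_sub, he, hne, hL] at key₁ key₂
  have key : ((S.card : ℝ) - 2) * |‖Matrix.toEuclideanLin Φ x‖ ^ 2 - ‖x‖ ^ 2| ≤
      t * (((S.card : ℝ) - 1) * ‖x‖ ^ 2) := by
    calc _ = |∑ i ∈ S, (‖Matrix.toEuclideanLin Φ (x - e i)‖ ^ 2 - ‖x - e i‖ ^ 2)| := by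
          rw [Finset.sum_sub_distrib, key₁, key₂, ← abs_of_pos (by linarith : 0 < (S.card : ℝ) - 2),
            ← abs_mul, abs_of_pos (by linarith : 0 < (S.card : ℝ) - 2)]
          congr 1
          ring
      _ ≤ ∑ i ∈ S, t * ‖x - e i‖ ^ 2 := by
          refine (Finset.abs_sum_le_sum_abs _ _).trans (Finset.sum_le_sum fun i hi => ?_)
          refine h i hi _ fun j hj => ?_
          by_cases hji : j = i
          · simp [hji, e]
          · have : j ∉ S := fun hjS => hj (Finset.mem_erase.2 ⟨hji, hjS⟩)
            simp [e, hji, hx j this]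
      _ = _ := by
          rw [← Finset.mul_sum, key₁]
          ring
  rw [div_mul_eq_mul_div, le_div_iff₀ (by linarith)]
  linarith

/-- Induction on s; the factors s / (s - 1) telescope. -/
lemma isometryOn_of_card_ge {Φ : Matrix (Fin n) (Fin N) ℂ} (hΦ : UnitColumns Φ) {m : ℕ}
    (hm : 2 ≤ m) {ε : ℝ} (h : ∀ T : Finset (Fin N), T.card = m → IsometryOn Φ T ε) {s : ℕ}
    (hs : m ≤ s) : ∀ S : Finset (Fin N), S.card = s →
      IsometryOn Φ S (ε * ((s : ℝ) - 1) / ((m : ℝ) - 1)) := by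
  have hm' : (2 : ℝ) ≤ m := by exact_mod_cast hm
  induction s, hs using Nat.le_induction with
  | base =>
    intro S hS
    rw [mul_div_cancel_right₀ _ (by linarith)]
    exact h S hS
  | succ s hs ih =>
    intro S hS
    have hs' : (2 : ℝ) ≤ s := by exact_mod_cast hm.trans hs
    have := IsometryOn.of_erase hΦ (S := S) (by lia) fun i hi =>
      ih (S.erase i) (by rw [Finset.card_erase_of_mem hi, hS]; rfl)
    refine this.mono le_rfl (le_of_eq ?_)
    rw [hS]
    push_cast
    have h₁ : (m : ℝ) - 1 ≠ 0 := by linarith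
    have h₂ : (s : ℝ) - 1 ≠ 0 := by linarith
    have h₃ : (s : ℝ) + 1 - 2 ≠ 0 := by linarith
    field_simp
    ring

theorem hasRIP_of_lazyCertifies {m k : ℕ} {δ : ℝ} {Φ : Matrix (Fin n) (Fin N) ℂ}
    (hm : 2 ≤ m) (hmN : m ≤ N) (hΦ : UnitColumns Φ) (h : LazyCertifies Φ m δ k) :
    HasRIP Φ k δ := by
  obtain ⟨hmk, hδ⟩ := h
  have hm' : (2 : ℝ) ≤ m := by exact_mod_cast hm
  have hε := ripParameter_nonneg Φ m
  have hT := (ripParameter_le_iff (Φ := Φ) (m := m) hε).1 le_rfl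
  have hS : ∀ S : Finset (Fin N), m ≤ S.card → S.card ≤ k → IsometryOn Φ S δ := by
    intro S hmS hSk
    refine (isometryOn_of_card_ge hΦ hm hT hmS S rfl).mono le_rfl (le_trans ?_ hδ)
    have : (S.card : ℝ) ≤ k := by exact_mod_cast hSk
    have : 0 ≤ (m : ℝ) - 1 := by linarith
    gcongr
  refine hasRIP_iff_isometryOn.2 fun S hSk => ?_
  rcases le_total m S.card with hmS | hSm
  · exact hS S hmS hSk
  -- Supports with fewer than m elements are padded to m-subsets, where the bound is already known.
  · obtain ⟨T, hST, hTm⟩ := Finset.exists_superset_card_eq hSm (by simpa using hmN)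
    exact (hS T hTm.ge (hTm.trans_le hmk)).mono hST le_rfl

/-! ### Real matrices -/

/-- The real counterpart of `IsometryOn`. -/
def RealIsometryOn (Φ : Matrix (Fin n) (Fin N) ℝ) (T : Finset (Fin N)) (t : ℝ) : Prop :=
  ∀ a : Fin N → ℝ, (∀ i ∉ T, a i = 0) →
    |∑ r, (∑ j, Φ r j * a j) ^ 2 - ∑ j, a j ^ 2| ≤ t * ∑ j, a j ^ 2

lemma complex_norm_sq (z : ℂ) : ‖z‖ ^ 2 = z.re ^ 2 + z.im ^ 2 := by
  rw [← Complex.normSq_eq_norm_sq, Complex.normSq_apply]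
  ring

lemma norm_sq_toEuclideanLin_map (Φ : Matrix (Fin n) (Fin N) ℝ) (x : EuclideanSpace ℂ (Fin N)) :
    ‖Matrix.toEuclideanLin (Φ.map fun a => (a : ℂ)) x‖ ^ 2 =
      ∑ r, (∑ j, Φ r j * (x j).re) ^ 2 + ∑ r, (∑ j, Φ r j * (x j).im) ^ 2 := by
  rw [EuclideanSpace.norm_sq_eq, ← Finset.sum_add_distrib]
  refine Finset.sum_congr rfl fun r _ => ?_
  rw [complex_norm_sq]
  simp [Matrix.toLpLin_apply, Matrix.mulVec, dotProduct]

lemma norm_sq_eq_re_add_im (x : EuclideanSpace ℂ (Fin N)) :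
    ‖x‖ ^ 2 = ∑ j, (x j).re ^ 2 + ∑ j, (x j).im ^ 2 := by
  rw [EuclideanSpace.norm_sq_eq, ← Finset.sum_add_distrib]
  exact Finset.sum_congr rfl fun r _ => complex_norm_sq _

/-- A real matrix acts separately on real and imaginary parts, and both sides of the inequality are
additive in them. -/
lemma isometryOn_map_iff {Φ : Matrix (Fin n) (Fin N) ℝ} {T : Finset (Fin N)} {t : ℝ} :
    IsometryOn (Φ.map fun a => (a : ℂ)) T t ↔ RealIsometryOn Φ T t := by
  constructor
  · intro h a ha
    have := h (WithLp.toLp 2 fun i => (a i : ℂ)) fun i hi => by simp [ha i hi]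
    rw [norm_sq_toEuclideanLin_map, norm_sq_eq_re_add_im] at this
    simpa using this
  · intro h x hx
    have h₁ := h (fun j => (x j).re) fun i hi => by simp [hx i hi]
    have h₂ := h (fun j => (x j).im) fun i hi => by simp [hx i hi]
    rw [norm_sq_toEuclideanLin_map, norm_sq_eq_re_add_im, mul_add, add_sub_add_comm]
    exact (abs_add_le _ _).trans (add_le_add h₁ h₂)

/-! ### Values of step-counted computations -/

@[simp] lemma bind_val {α β : Type} (x : Timed α) (f : α → Timed β) :
    (x >>= f).val = (f x.val).val := rfl

@[simp] lemma step_val {α : Type} (a : α) : (step a).val = a := rfl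

@[simp] lemma add_val (x y : ℝ) : (add x y).val = x + y := rfl

@[simp] lemma sub_val (x y : ℝ) : (sub x y).val = x - y := rfl

@[simp] lemma mul_val (x y : ℝ) : (mul x y).val = x * y := rfl

@[simp] lemma div_val (x y : ℝ) : (div x y).val = x / y := rfl

@[simp] lemma lt_val (x y : ℝ) : (lt x y).val = true ↔ x < y := by simp [lt]

@[simp] lemma eq_val (x y : ℝ) : (eq x y).val = true ↔ x = y := by simp [eq]

@[simp] lemma fetch_val {α : Type} (l : List α) (i : Fin l.length) : (fetch l i).val = l.get i :=
  rfl

@[simp] lemma tabulate_val {d : ℕ} (f : Fin d → Fin d → Timed ℝ) :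
    (tabulate f).val = .of fun i j => (f i j).val := rfl

lemma ite_val {α : Type} (p : Prop) [Decidable p] (x y : Timed α) :
    (if p then x else y).val = if p then x.val else y.val := by
  split_ifs <;> rfl

@[simp] lemma sumLoop_val {ι : Type} (f : ι → Timed ℝ) (l : List ι) :
    (sumLoop f l).val = (l.map fun i => (f i).val).sum := by
  induction l with
  | nil => rfl
  | cons i l ih => simp [sumLoop, ih]

lemma sumLoop_finRange_val (f : Fin n → Timed ℝ) :
    (sumLoop f (List.finRange n)).val = ∑ i, (f i).val := by
  rw [sumLoop_val, ← List.ofFn_eq_map, List.sum_ofFn]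

@[simp] lemma allLoop_val {ι : Type} (f : ι → Timed Bool) (l : List ι) :
    (allLoop f l).val = true ↔ ∀ i ∈ l, (f i).val = true := by
  induction l with
  | nil => simp [allLoop]
  | cons i l ih => simp [allLoop, ite_val, ih]

lemma mem_filterLoop_val {ι : Type} (f : ι → Timed Bool) (l : List ι) (k : ι) :
    k ∈ (filterLoop f l).val ↔ k ∈ l ∧ (f k).val = true := by
  induction l with
  | nil => simp [filterLoop]
  | cons i l ih =>
    by_cases h : (f i).val = true
    · simp only [filterLoop, bind_val, h, if_true, step_val, List.mem_cons, ih]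
      constructor
      · rintro (rfl | h') <;> tauto
      · tauto
    · simp only [filterLoop, bind_val, h, if_false, step_val, List.mem_cons, ih, Bool.false_eq_true]
      constructor
      · tauto
      · rintro ⟨rfl | h₁, h₂⟩
        · exact absurd h₂ h
        · exact ⟨h₁, h₂⟩

/-! ### Symmetric Gaussian elimination -/

/-- The quadratic form of a square matrix. -/
def quadForm {d : ℕ} (M : Matrix (Fin d) (Fin d) ℝ) (x : Fin d → ℝ) : ℝ :=
  ∑ i, ∑ j, x i * M i j * x j

lemma quadForm_cons {d : ℕ} {M : Matrix (Fin (d + 1)) (Fin (d + 1)) ℝ}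
    (hM : ∀ i j, M i j = M j i) (s : ℝ) (y : Fin d → ℝ) :
    quadForm M (Fin.cons s y) = M 0 0 * s ^ 2 + 2 * s * ∑ j, M 0 j.succ * y j +
      quadForm (.of fun i j => M i.succ j.succ) y := by
  have h : ∑ i, y i * M i.succ 0 * s = s * ∑ j, M 0 j.succ * y j := by
    rw [Finset.mul_sum]
    exact Finset.sum_congr rfl fun i _ => by rw [hM i.succ 0]; ring
  have h' : ∑ j, s * M 0 j.succ * y j = s * ∑ j, M 0 j.succ * y j := by
    rw [Finset.mul_sum]
    exact Finset.sum_congr rfl fun i _ => by ring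
  simp only [quadForm, Fin.sum_univ_succ, Fin.cons_zero, Fin.cons_succ, Finset.sum_add_distrib, h,
    h', Matrix.of_apply]
  ring

lemma quadForm_schur {d : ℕ} {M : Matrix (Fin (d + 1)) (Fin (d + 1)) ℝ}
    (hM : ∀ i j, M i j = M j i) (y : Fin d → ℝ) :
    quadForm (.of fun i j => M i.succ j.succ - M i.succ 0 * M 0 j.succ / M 0 0) y =
      quadForm (.of fun i j => M i.succ j.succ) y - (∑ j, M 0 j.succ * y j) ^ 2 / M 0 0 := by
  simp only [quadForm, Matrix.of_apply]
  rw [sq, Finset.sum_mul_sum, Finset.sum_div, ← Finset.sum_sub_distrib]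
  refine Finset.sum_congr rfl fun i _ => ?_
  rw [Finset.sum_div, ← Finset.sum_sub_distrib]
  refine Finset.sum_congr rfl fun j _ => ?_
  rw [hM i.succ 0]
  ring

lemma forall_fin_cons {d : ℕ} {P : (Fin (d + 1) → ℝ) → Prop} :
    (∀ x, P x) ↔ ∀ s y, P (Fin.cons s y) :=
  ⟨fun h _ _ => h _, fun h x => by simpa using h (x 0) (Fin.tail x)⟩

/-- The form is split as M₀₀ s² + 2 s b(y) + (form of the lower block). For a positive pivot,
minimizing over s leaves the Schur complement; for a zero pivot the linear term in s must vanish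
identically. -/
lemma psdTest_val {d : ℕ} {M : Matrix (Fin d) (Fin d) ℝ} (hM : ∀ i j, M i j = M j i) :
    (psdTest d M).val = true ↔ ∀ x, 0 ≤ quadForm M x := by
  induction d with
  | zero => simp [psdTest, quadForm]
  | succ d ih =>
    simp only [psdTest, bind_val]
    simp only [forall_fin_cons, quadForm_cons hM]
    rcases lt_trichotomy (M 0 0) 0 with h | h | h
    · rw [if_pos ((lt_val _ _).2 h)]
      simp only [step_val, Bool.false_eq_true, false_iff, not_forall, not_le]
      exact ⟨1, 0, by simpa [quadForm] using h⟩
    · rw [if_neg (by simp [lt, h]), bind_val, if_pos ((eq_val _ _).2 h), bind_val]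
      by_cases hrow : ∀ j : Fin d, M 0 j.succ = 0
      · rw [if_pos (by simpa using hrow), bind_val, tabulate_val,
          ih (M := .of fun i j => (step (M i.succ j.succ)).val) (fun i j => hM _ _)]
        simp only [step_val, h, hrow, zero_mul, Finset.sum_const_zero, mul_zero, zero_add]
        exact ⟨fun h _ => h, fun h => h 0⟩
      · rw [if_neg (by simpa using hrow)]
        simp only [step_val, Bool.false_eq_true, false_iff]
        intro hall
        push Not at hrow
        obtain ⟨j, hj⟩ := hrow
        set q := quadForm (.of fun i j => M (Fin.succ i) (Fin.succ j)) (Pi.single j 1)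
        -- With zero pivot and M₀ⱼ ≠ 0 the form is affine in s; this s gives it the value -1.
        have := hall (-(q + 1) / (2 * M 0 j.succ)) (Pi.single j 1)
        simp only [h, Pi.single_apply, mul_ite, mul_one, mul_zero, Finset.sum_ite_eq',
          Finset.mem_univ, if_true] at this
        have h2 : 2 * (-(q + 1) / (2 * M 0 j.succ)) * M 0 j.succ = -(q + 1) := by field_simp
        rw [h2] at this
        linarith
    · rw [if_neg (by simp [lt, h.le]), bind_val, if_neg (by simp [eq, h.ne']), bind_val]
      simp only [tabulate_val, bind_val, mul_val, div_val, sub_val]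
      rw [ih (M := .of fun i j => M i.succ j.succ - M i.succ 0 * M 0 j.succ / M 0 0) fun i j => by
        change M i.succ j.succ - M i.succ 0 * M 0 j.succ / M 0 0 =
          M j.succ i.succ - M j.succ 0 * M 0 i.succ / M 0 0
        rw [hM i.succ j.succ, hM i.succ 0, hM 0 j.succ, mul_comm]]
      simp only [quadForm_schur hM]
      constructor
      · intro hall s y
        have h₁ := hall y
        set b := ∑ j, M 0 (Fin.succ j) * y j
        have h₂ : M 0 0 * s ^ 2 + 2 * s * b + b ^ 2 / M 0 0 = M 0 0 * (s + b / M 0 0) ^ 2 := by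
          field_simp
          ring
        have h₃ : 0 ≤ M 0 0 * (s + b / M 0 0) ^ 2 := by positivity
        linarith
      · intro hall y
        -- The minimizer in s, at which the form equals the Schur complement at y.
        have h₁ := hall (-(∑ j, M 0 (Fin.succ j) * y j) / M 0 0) y
        set b := ∑ j, M 0 (Fin.succ j) * y j
        have h₂ : M 0 0 * (-b / M 0 0) ^ 2 + 2 * (-b / M 0 0) * b = - (b ^ 2 / M 0 0) := by
          field_simp
          ring
        linarith

/-! ### The test on a set of columns -/

lemma sum_eq_sum_get {l : List (Fin N)} (hl : l.Nodup) {f : Fin N → ℝ}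
    (hf : ∀ i ∉ l, f i = 0) : ∑ i, f i = ∑ i : Fin l.length, f (l.get i) := by
  rw [← Finset.sum_subset (Finset.subset_univ l.toFinset) fun i _ hi => hf i (by simpa using hi),
    ← Finset.sum_image (s := Finset.univ) (g := l.get) fun i _ j _ h => hl.injective_get h]
  congr 1
  ext i
  simp [List.mem_iff_get]

lemma quadForm_gram {d : ℕ} (v : Fin n → Fin d → ℝ) (y : Fin d → ℝ) :
    quadForm (.of fun i j => ∑ r, v r i * v r j) y = ∑ r, (∑ i, v r i * y i) ^ 2 := by
  simp only [quadForm, sq, Finset.mul_sum, Finset.sum_mul, Matrix.of_apply]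
  conv_lhs => enter [2, i]; rw [Finset.sum_comm]
  rw [Finset.sum_comm]
  refine Finset.sum_congr rfl fun r _ => ?_
  rw [Finset.sum_comm]
  refine Finset.sum_congr rfl fun i _ => Finset.sum_congr rfl fun j _ => by ring

lemma quadForm_sub {d : ℕ} (A B : Fin d → Fin d → ℝ) (y : Fin d → ℝ) :
    quadForm (.of fun i j => A i j - B i j) y = quadForm (.of A) y - quadForm (.of B) y := by
  simp only [quadForm, Matrix.of_apply, mul_sub, sub_mul, Finset.sum_sub_distrib]

lemma quadForm_diagonal {d : ℕ} (c : ℝ) (y : Fin d → ℝ) :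
    quadForm (.of fun i j => if i = j then c else 0) y = c * ∑ i, y i ^ 2 := by
  simp only [quadForm, Matrix.of_apply, mul_ite, ite_mul, mul_zero, zero_mul, Finset.sum_ite_eq, Finset.mem_univ,
    if_true, Finset.mul_sum]
  exact Finset.sum_congr rfl fun i _ => by ring

lemma realIsometryOn_toFinset_iff {Φ : Matrix (Fin n) (Fin N) ℝ} {l : List (Fin N)}
    (hl : l.Nodup) {t : ℝ} : RealIsometryOn Φ l.toFinset t ↔ ∀ y : Fin l.length → ℝ,
      |∑ r, (∑ i, Φ r (l.get i) * y i) ^ 2 - ∑ i, y i ^ 2| ≤ t * ∑ i, y i ^ 2 := by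
  have key : ∀ a : Fin N → ℝ, (∀ i ∉ l.toFinset, a i = 0) →
      ∑ r, (∑ j, Φ r j * a j) ^ 2 = ∑ r, (∑ i, Φ r (l.get i) * a (l.get i)) ^ 2 ∧
      ∑ j, a j ^ 2 = ∑ i : Fin l.length, a (l.get i) ^ 2 := by
    intro a ha
    have ha' : ∀ i ∉ l, a i = 0 := fun i hi => ha i (by simpa using hi)
    refine ⟨Finset.sum_congr rfl fun r _ => ?_, sum_eq_sum_get hl fun i hi => by simp [ha' i hi]⟩
    rw [sum_eq_sum_get hl fun i hi => by simp [ha' i hi]]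
  constructor
  · intro h y
    have hy : ∀ i, Function.extend l.get y 0 (l.get i) = y i := fun i =>
      hl.injective_get.extend_apply y 0 i
    have ha : ∀ i ∉ l.toFinset, Function.extend l.get y 0 i = 0 := by
      intro i hi
      refine Function.extend_apply' _ _ _ ?_
      rintro ⟨j, rfl⟩
      exact hi (by simp)
    have := h _ ha
    rw [(key _ ha).1, (key _ ha).2] at this
    simpa only [hy] using this
  · intro h a ha
    rw [(key a ha).1, (key a ha).2]
    exact h _

lemma subsetTest_val {Φ : Matrix (Fin n) (Fin N) ℝ} {t : ℝ} {l : List (Fin N)} (hl : l.Nodup) :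
    (subsetTest Φ t l).val = true ↔ RealIsometryOn Φ l.toFinset t := by
  rw [realIsometryOn_toFinset_iff hl]
  let G : Fin l.length → Fin l.length → ℝ := fun i j => ∑ r, Φ r (l.get i) * Φ r (l.get j)
  have hG : ∀ i j, G i j = G j i := fun i j => Finset.sum_congr rfl fun r _ => mul_comm _ _
  have hval : (subsetTest Φ t l).val =
      ((psdTest _ (.of fun i j => (if i = j then 1 + t else 0) - G i j)).val &&
        (psdTest _ (.of fun i j => G i j - (if i = j then 1 - t else 0))).val) := by
    simp only [subsetTest, bind_val, step_val]
    congr 4 <;> ext i j <;>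
      simp only [tabulate_val, Matrix.of_apply] <;> split_ifs <;>
      simp only [bind_val, sub_val, add_val, step_val, G,
        sumLoop_finRange_val, fetch_val, mul_val]
  rw [hval, Bool.and_eq_true, psdTest_val (fun i j => by simp only [Matrix.of_apply, hG i j, eq_comm]),
    psdTest_val (fun i j => by simp only [Matrix.of_apply, hG i j, eq_comm]), ← forall_and]
  refine forall_congr' fun y => ?_
  rw [quadForm_sub (fun i j => if i = j then 1 + t else 0) G,
    quadForm_sub G (fun i j => if i = j then 1 - t else 0), quadForm_diagonal, quadForm_diagonal,
    quadForm_gram (fun r i => Φ r (l.get i)), abs_le]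
  constructor <;> rintro ⟨h₁, h₂⟩ <;> constructor <;> linarith

/-! ### The enumeration of the subsets -/

/-- Chosen elements are pushed to the front of the accumulator, hence the reversal of the sublist.
-/
lemma allSubsets_val {α : Type} (test : List α → Timed Bool) (m : ℕ) (l chosen : List α) :
    (allSubsets test m l chosen).val = true ↔
      ∀ s : List α, s.Sublist l → s.length = m → (test (s.reverse ++ chosen)).val = true := by
  induction l generalizing m chosen with
  | nil =>
    cases m with
    | zero => simp [allSubsets]
    | succ m =>
      simp only [allSubsets, step_val, List.sublist_nil, true_iff]
      rintro s rfl hs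
      simp at hs
  | cons a l ih =>
    cases m with
    | zero =>
      simp only [allSubsets, List.length_eq_zero_iff]
      exact ⟨fun h s _ hs => by simpa [hs] using h, fun h => by simpa using h [] (by simp) rfl⟩
    | succ m =>
      simp only [allSubsets, bind_val, step_val, Bool.and_eq_true, ih]
      constructor
      · rintro ⟨h₁, h₂⟩ s hs hm
        rcases List.sublist_cons_iff.1 hs with hs | ⟨r, rfl, hr⟩
        · exact h₂ s hs hm
        · simpa using h₁ r hr (by simpa using hm)
      · intro h
        exact ⟨fun s hs hm => by simpa using h (a :: s) (hs.cons_cons a) (by simpa using hm),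
          fun s hs hm => h s (hs.cons a) hm⟩

lemma allSubsets_subsetTest_val {Φ : Matrix (Fin n) (Fin N) ℝ} {t : ℝ} {m : ℕ} :
    (allSubsets (subsetTest Φ t) m (List.finRange N) []).val = true ↔
      ∀ T : Finset (Fin N), T.card = m → RealIsometryOn Φ T t := by
  rw [allSubsets_val]
  simp only [List.append_nil]
  constructor
  · intro h T hT
    -- The increasing listing of T is the sublist at which the enumeration meets T.
    set s := (List.finRange N).filter (· ∈ T)
    have hs : s.Nodup := (List.nodup_finRange N).filter _
    have hsT : s.toFinset = T := by
      ext i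
      simp [s]
    have := h s List.filter_sublist (by rw [← List.toFinset_card_of_nodup hs, hsT, hT])
    rw [subsetTest_val (List.nodup_reverse.2 hs), List.toFinset_reverse, hsT] at this
    exact this
  · intro h s hs hm
    have hn : s.Nodup := hs.nodup (List.nodup_finRange N)
    rw [subsetTest_val (List.nodup_reverse.2 hn)]
    refine h _ ?_
    rw [List.toFinset_card_of_nodup (List.nodup_reverse.2 hn), List.length_reverse, hm]

theorem mem_lazyProgram_iff {m k : ℕ} {δ : ℝ} {Φ : Matrix (Fin n) (Fin N) ℝ} (hm : 2 ≤ m)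
    (hmN : m ≤ N) (hδ : 0 < δ) :
    k ∈ (lazyProgram Φ m δ).val ↔
      k ≤ N ∧ LazyCertifies (Φ.map fun a => (a : ℂ)) m δ k := by
  have hm' : (2 : ℝ) ≤ m := by exact_mod_cast hm
  rw [lazyProgram, mem_filterLoop_val, LazyCertifies, List.mem_range'_1, ← and_assoc]
  have h₁ : m ≤ k ∧ k < m + (N + 1 - m) ↔ k ≤ N ∧ m ≤ k := by lia
  rw [h₁]
  refine and_congr_right fun ⟨_, hmk⟩ => ?_
  have hk' : (2 : ℝ) ≤ k := by exact_mod_cast hm.trans hmk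
  have ht : 0 ≤ δ * ((m : ℝ) - 1) / ((k : ℝ) - 1) :=
    div_nonneg (mul_nonneg hδ.le (by linarith)) (by linarith)
  simp only [bind_val, sub_val, mul_val, div_val, allSubsets_subsetTest_val]
  -- The rule ε(k - 1)/(m - 1) ≤ δ is solved for ε, giving the threshold that the program computes.
  rw [div_le_iff₀ (by linarith), ← le_div_iff₀ (by linarith), ripParameter_le_iff ht]
  simp only [isometryOn_map_iff]

/-! ### Concentration of squares of sub-Gaussian variables -/

section subgaussian

variable {Ω : Type*} [MeasurableSpace Ω] {μ : Measure Ω}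

lemma exp_le_one_add_add_sq_mul_exp_abs (z : ℝ) :
    Real.exp z ≤ 1 + z + z ^ 2 * Real.exp |z| := by
  have h := Complex.norm_exp_sub_sum_le_norm_mul_exp z 2
  rw [Finset.sum_range_succ, Finset.sum_range_one] at h
  have h' : Complex.exp z - ((z : ℂ) ^ 0 / (Nat.factorial 0 : ℕ) + (z : ℂ) ^ 1 / (Nat.factorial 1 : ℕ)) =
      ((Real.exp z - (1 + z) : ℝ) : ℂ) := by
    push_cast
    simp
  rw [h', Complex.norm_real, Complex.norm_real, Real.norm_eq_abs, Real.norm_eq_abs, sq_abs] at h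
  linarith [le_abs_self (Real.exp z - (1 + z))]

/-- Completing the square writes exp(q²/8) as a Gaussian mixture of exponentials linear in q, to
which a bound on the moment generating function applies. -/
lemma lintegral_exp_mul_sub_sq (q : ℝ) :
    ∫⁻ s, ENNReal.ofReal (Real.exp (s * q - 2 * s ^ 2)) =
      ENNReal.ofReal (Real.exp (q ^ 2 / 8)) * ENNReal.ofReal (Real.sqrt (Real.pi / 2)) := by
  have h : ∀ s : ℝ, Real.exp (s * q - 2 * s ^ 2) =
      Real.exp (q ^ 2 / 8) * Real.exp (-2 * (s - q / 4) ^ 2) := fun s => by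
    rw [← Real.exp_add]
    congr 1
    ring
  simp only [h, ENNReal.ofReal_mul (Real.exp_pos _).le]
  rw [lintegral_const_mul _ (by fun_prop),
    lintegral_sub_right_eq_self (fun s : ℝ => ENNReal.ofReal (Real.exp (-2 * s ^ 2))) (q / 4),
    ← ofReal_integral_eq_lintegral_ofReal (integrable_exp_neg_mul_sq two_pos)
      (Filter.Eventually.of_forall fun _ => (Real.exp_pos _).le), integral_gaussian]

/-- After Tonelli, E exp(sQ) ≤ exp(s²/2) leaves a Gaussian integral in s with exponent -3s²/2; the
quotient of the two Gaussian integrals is √(4/3) ≤ 2. -/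
lemma lintegral_exp_sq_div_eight_le [IsProbabilityMeasure μ] {Q : Ω → ℝ} (hQm : Measurable Q)
    (hQ : HasSubgaussianMGF Q 1 μ) :
    ∫⁻ ω, ENNReal.ofReal (Real.exp (Q ω ^ 2 / 8)) ∂μ ≤ ENNReal.ofReal 2 := by
  have hpos : 0 < Real.sqrt (Real.pi / 2) := Real.sqrt_pos.2 (by positivity)
  have h₀ : ENNReal.ofReal (Real.sqrt (Real.pi / 2)) ≠ 0 := by simpa using hpos
  rw [← ENNReal.mul_le_mul_iff_left h₀ ENNReal.ofReal_ne_top]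
  calc (∫⁻ ω, ENNReal.ofReal (Real.exp (Q ω ^ 2 / 8)) ∂μ) * ENNReal.ofReal (Real.sqrt (Real.pi / 2))
      = ∫⁻ ω, ∫⁻ s, ENNReal.ofReal (Real.exp (s * Q ω - 2 * s ^ 2)) ∂volume ∂μ := by
        rw [← lintegral_mul_const _ (by fun_prop)]
        simp only [lintegral_exp_mul_sub_sq]
    _ = ∫⁻ s, ∫⁻ ω, ENNReal.ofReal (Real.exp (s * Q ω - 2 * s ^ 2)) ∂μ :=
        lintegral_lintegral_swap (by fun_prop)
    _ ≤ ∫⁻ s : ℝ, ENNReal.ofReal (Real.exp (-(3 / 2) * s ^ 2)) := by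
        refine lintegral_mono fun s => ?_
        rw [← ofReal_integral_eq_lintegral_ofReal]
        · refine ENNReal.ofReal_le_ofReal ?_
          have := hQ.mgf_le s
          simp only [Real.exp_sub, div_eq_mul_inv]
          rw [integral_mul_const, ← div_eq_mul_inv, div_le_iff₀ (Real.exp_pos _), ← Real.exp_add]
          refine this.trans (Real.exp_le_exp.2 ?_)
          push_cast
          linarith
        · simp only [Real.exp_sub]
          exact (hQ.integrable_exp_mul s).div_const _
        · exact Filter.Eventually.of_forall fun _ => (Real.exp_pos _).le
    _ = ENNReal.ofReal (Real.sqrt (Real.pi / (3 / 2))) := by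
        rw [← ofReal_integral_eq_lintegral_ofReal (integrable_exp_neg_mul_sq (by norm_num))
          (Filter.Eventually.of_forall fun _ => (Real.exp_pos _).le), integral_gaussian]
    _ ≤ ENNReal.ofReal 2 * ENNReal.ofReal (Real.sqrt (Real.pi / 2)) := by
        rw [← ENNReal.ofReal_mul zero_le_two]
        refine ENNReal.ofReal_le_ofReal ?_
        rw [Real.sqrt_le_left (by positivity), mul_pow, Real.sq_sqrt (by positivity)]
        linarith [Real.pi_pos]

lemma integrable_exp_sq_div_eight [IsProbabilityMeasure μ] {Q : Ω → ℝ} (hQm : Measurable Q)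
    (hQ : HasSubgaussianMGF Q 1 μ) : Integrable (fun ω => Real.exp (Q ω ^ 2 / 8)) μ := by
  refine ⟨by fun_prop, ?_⟩
  rw [hasFiniteIntegral_iff_ofReal (Filter.Eventually.of_forall fun _ => (Real.exp_pos _).le)]
  exact (lintegral_exp_sq_div_eight_le hQm hQ).trans_lt ENNReal.ofReal_lt_top

lemma integral_exp_sq_div_eight_le [IsProbabilityMeasure μ] {Q : Ω → ℝ} (hQm : Measurable Q)
    (hQ : HasSubgaussianMGF Q 1 μ) : ∫ ω, Real.exp (Q ω ^ 2 / 8) ∂μ ≤ 2 := by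
  have h := lintegral_exp_sq_div_eight_le hQm hQ
  rwa [← ofReal_integral_eq_lintegral_ofReal (integrable_exp_sq_div_eight hQm hQ)
    (Filter.Eventually.of_forall fun _ => (Real.exp_pos _).le),
    ENNReal.ofReal_le_ofReal_iff zero_le_two] at h

/-- Keeping the linear term exact lets it vanish in expectation. With |l| ≤ 1/16 the remainder's
exponential is at most exp((w + 1)/16); a second such factor absorbs (w - 1)², and the product is of
size exp(w/8), whose mean is bounded. -/
lemma exp_mul_sub_one_le {w l : ℝ} (hw : 0 ≤ w) (hl : |l| ≤ 1 / 16) :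
    Real.exp (l * (w - 1)) ≤ 1 + l * (w - 1) + 1024 * l ^ 2 * Real.exp (w / 8) := by
  have h₁ := exp_le_one_add_add_sq_mul_exp_abs (l * (w - 1))
  have h₂ : |w - 1| ≤ w + 1 := abs_le.2 ⟨by linarith, by linarith⟩
  have h₃ : |l * (w - 1)| ≤ (w + 1) / 16 := by
    rw [abs_mul]
    calc |l| * |w - 1| ≤ 1 / 16 * (w + 1) := by gcongr
      _ = _ := by ring
  have h₄ : (w - 1) ^ 2 ≤ 512 * Real.exp ((w + 1) / 16) := by
    have := Real.quadratic_le_exp_of_nonneg (x := (w + 1) / 16) (by positivity)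
    nlinarith
  have h₅ : Real.exp ((w + 1) / 16) * Real.exp ((w + 1) / 16) ≤ 2 * Real.exp (w / 8) := by
    rw [← Real.exp_add, show (w + 1) / 16 + (w + 1) / 16 = 1 / 8 + w / 8 by ring, Real.exp_add]
    gcongr
    have : Real.exp (1 / 8) ≤ Real.exp (Real.log 2) :=
      Real.exp_le_exp.2 (by linarith [Real.log_two_gt_d9])
    rwa [Real.exp_log two_pos] at this
  have h₆ : (l * (w - 1)) ^ 2 * Real.exp |l * (w - 1)| ≤ 1024 * l ^ 2 * Real.exp (w / 8) := by
    calc _ ≤ (l ^ 2 * (512 * Real.exp ((w + 1) / 16))) * Real.exp ((w + 1) / 16) := by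
          rw [mul_pow]
          gcongr
      _ = 512 * l ^ 2 * (Real.exp ((w + 1) / 16) * Real.exp ((w + 1) / 16)) := by ring
      _ ≤ 512 * l ^ 2 * (2 * Real.exp (w / 8)) := by gcongr
      _ = _ := by ring
  linarith

lemma integrable_exp_mul_sq_sub_one [IsProbabilityMeasure μ] {Q : Ω → ℝ} (hQm : Measurable Q)
    (hQ : HasSubgaussianMGF Q 1 μ) {l : ℝ} (hl : |l| ≤ 1 / 16) :
    Integrable (fun ω => Real.exp (l * (Q ω ^ 2 - 1))) μ := by
  refine ((integrable_exp_sq_div_eight hQm hQ).const_mul (Real.exp 1)).mono' (by fun_prop)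
    (Filter.Eventually.of_forall fun ω => ?_)
  rw [Real.norm_eq_abs, abs_of_pos (Real.exp_pos _), ← Real.exp_add]
  refine Real.exp_le_exp.2 ?_
  have := abs_le.1 hl
  nlinarith [sq_nonneg (Q ω)]

lemma mgf_sq_sub_one_le [IsProbabilityMeasure μ] {Q : Ω → ℝ} (hQm : Measurable Q)
    (hQ : HasSubgaussianMGF Q 1 μ) (hQ2 : ∫ ω, Q ω ^ 2 ∂μ = 1) {l : ℝ} (hl : |l| ≤ 1 / 16) :
    mgf (fun ω => Q ω ^ 2 - 1) μ l ≤ Real.exp (2048 * l ^ 2) := by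
  have hi := integrable_exp_sq_div_eight hQm hQ
  have hs : Integrable (fun ω => Q ω ^ 2) μ := (hQ.memLp 2).integrable_sq
  have hs' : Integrable (fun ω => l * (Q ω ^ 2 - 1)) μ :=
    (hs.sub (integrable_const 1)).const_mul l
  calc mgf (fun ω => Q ω ^ 2 - 1) μ l
      ≤ ∫ ω, (1 + l * (Q ω ^ 2 - 1) + 1024 * l ^ 2 * Real.exp (Q ω ^ 2 / 8)) ∂μ :=
        integral_mono (integrable_exp_mul_sq_sub_one hQm hQ hl)
          (((integrable_const 1).add hs').add (hi.const_mul _))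
          fun ω => exp_mul_sub_one_le (sq_nonneg _) hl
    _ = 1 + 1024 * l ^ 2 * ∫ ω, Real.exp (Q ω ^ 2 / 8) ∂μ := by
        have h₁ : Integrable (fun ω => 1 + l * (Q ω ^ 2 - 1)) μ := (integrable_const 1).add hs'
        rw [integral_add h₁ (hi.const_mul _), integral_add (integrable_const 1) hs', integral_const_mul, integral_const_mul,
          integral_sub hs (integrable_const 1), hQ2]
        simp
    _ ≤ 1 + 1024 * l ^ 2 * 2 := by
        gcongr
        exact integral_exp_sq_div_eight_le hQm hQ
    _ ≤ Real.exp (2048 * l ^ 2) := by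
        linarith [Real.add_one_le_exp (2048 * l ^ 2)]

/-- Chernoff's bound; independence turns the moment generating function of the sum into a product.
-/
lemma measureReal_sum_ge_le_of_mgf_le [IsProbabilityMeasure μ] {n : ℕ} {X : Fin n → Ω → ℝ}
    (hX : iIndepFun X μ) (hXm : ∀ i, Measurable (X i)) {l K a : ℝ} (hl : 0 ≤ l)
    (hint : ∀ i, Integrable (fun ω => Real.exp (l * X i ω)) μ)
    (hmgf : ∀ i, mgf (X i) μ l ≤ Real.exp K) :
    μ.real {ω | a * n ≤ ∑ i, X i ω} ≤ Real.exp (-(l * a - K) * n) := by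
  have h := measure_ge_le_exp_mul_mgf (μ := μ) (X := ∑ i, X i) (a * n) hl
    (hX.integrable_exp_mul_sum hXm fun i _ => hint i)
  simp only [Finset.sum_apply] at h
  refine h.trans ?_
  rw [hX.mgf_sum hXm]
  calc Real.exp (-l * (a * n)) * ∏ i, mgf (X i) μ l
      ≤ Real.exp (-l * (a * n)) * ∏ _i : Fin n, Real.exp K := by
        gcongr
        exacts [fun _ _ => mgf_nonneg, hmgf _]
    _ = _ := by
        rw [Finset.prod_const, Finset.card_univ, Fintype.card_fin, ← Real.exp_nat_mul,
          ← Real.exp_add]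
        congr 1
        ring

lemma measureReal_abs_sum_sq_sub_one_ge_le [IsProbabilityMeasure μ] {n : ℕ} {Q : Fin n → Ω → ℝ}
    (hQi : iIndepFun Q μ) (hQm : ∀ i, Measurable (Q i))
    (hQ : ∀ i, HasSubgaussianMGF (Q i) 1 μ) (hQ2 : ∀ i, ∫ ω, Q i ω ^ 2 ∂μ = 1) {a : ℝ}
    (ha : 0 ≤ a) (ha1 : a ≤ 1) :
    μ.real {ω | a * n ≤ |∑ i, (Q i ω ^ 2 - 1)|} ≤ 2 * Real.exp (-(a ^ 2 / 8192) * n) := by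
  have hl : |a / 4096| ≤ 1 / 16 := by
    rw [abs_of_nonneg (by positivity)]
    linarith
  have hl' : |-(a / 4096)| ≤ 1 / 16 := by rwa [abs_neg]
  -- The value l = a/4096 maximizes l a - 2048 l², with maximum a²/8192. The lower tail uses the
  -- same l for the negated variables.
  have h₁ := measureReal_sum_ge_le_of_mgf_le (μ := μ) (X := fun i ω => Q i ω ^ 2 - 1)
    (hQi.comp (fun _ q => q ^ 2 - 1) fun _ => by fun_prop) (fun i => by fun_prop) (a := a)
    (l := a / 4096) (by positivity) (fun i => integrable_exp_mul_sq_sub_one (hQm i) (hQ i) hl)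
    (fun i => mgf_sq_sub_one_le (hQm i) (hQ i) (hQ2 i) hl)
  have h₂ := measureReal_sum_ge_le_of_mgf_le (μ := μ) (X := fun i ω => -(Q i ω ^ 2 - 1))
    (hQi.comp (fun _ q => -(q ^ 2 - 1)) fun _ => by fun_prop) (fun i => by fun_prop) (a := a)
    (l := a / 4096) (K := 2048 * (-(a / 4096)) ^ 2) (by positivity)
    (fun i => by
      simpa only [neg_mul, mul_neg] using integrable_exp_mul_sq_sub_one (hQm i) (hQ i) hl')
    (fun i => by
      have := mgf_sq_sub_one_le (hQm i) (hQ i) (hQ2 i) hl'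
      simpa only [mgf, neg_mul, mul_neg] using this)
  have hsub : {ω | a * n ≤ |∑ i, (Q i ω ^ 2 - 1)|} ⊆
      {ω | a * n ≤ ∑ i, (Q i ω ^ 2 - 1)} ∪ {ω | a * n ≤ ∑ i, -(Q i ω ^ 2 - 1)} := by
    intro ω hω
    rw [Set.mem_union, Set.mem_ofPred_eq, Set.mem_ofPred_eq, Finset.sum_neg_distrib]
    exact le_abs.1 hω
  refine (measureReal_mono hsub).trans ((measureReal_union_le _ _).trans ?_)
  have e₁ : -(a / 4096 * a - 2048 * (a / 4096) ^ 2) = -(a ^ 2 / 8192) := by ring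
  have e₂ : -(a / 4096 * a - 2048 * (-(a / 4096)) ^ 2) = -(a ^ 2 / 8192) := by ring
  rw [e₁] at h₁
  rw [e₂] at h₂
  linarith

end subgaussian

/-! ### Random sign matrices -/

namespace IsSymmetricBernoulli

variable {Ω : Type*} [MeasurableSpace Ω] {μ : Measure Ω}
  {A : Ω → Matrix (Fin n) (Fin N) ℝ}

lemma iIndepFun_row (hA : IsSymmetricBernoulli μ A) (i : Fin n) :
    iIndepFun (fun j ω => A ω i j) μ :=
  hA.indep.precomp (g := fun j => (i, j)) fun _ _ h => (Prod.ext_iff.1 h).2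

lemma iIndepFun_row_mul (hA : IsSymmetricBernoulli μ A) (i : Fin n) (x : Fin N → ℝ) :
    iIndepFun (fun j ω => x j * A ω i j) μ :=
  (hA.iIndepFun_row i).comp (fun j a => x j * a) fun j => by fun_prop

variable [IsProbabilityMeasure μ]

lemma ae_eq_one_or_eq_neg_one (hA : IsSymmetricBernoulli μ A) (i : Fin n) (j : Fin N) :
    ∀ᵐ ω ∂μ, A ω i j = 1 ∨ A ω i j = -1 := by
  have h1 : MeasurableSet {ω | A ω i j = 1} := hA.measurable i j (measurableSet_singleton 1)
  have h2 : MeasurableSet {ω | A ω i j = -1} := hA.measurable i j (measurableSet_singleton (-1))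
  have hdisj : Disjoint {ω | A ω i j = 1} {ω | A ω i j = -1} := by
    rw [Set.disjoint_left]
    intro ω (h₁ : _ = _) (h₂ : _ = _)
    rw [h₁] at h₂
    norm_num at h₂
  have h : μ ({ω | A ω i j = 1} ∪ {ω | A ω i j = -1}) = 1 := by
    rw [measure_union hdisj h2, hA.prob_one, hA.prob_neg_one, ENNReal.add_halves]
  rw [← prob_compl_eq_zero_iff (h1.union h2)] at h
  exact h

lemma integral_entry (hA : IsSymmetricBernoulli μ A) (i : Fin n) (j : Fin N) :
    ∫ ω, A ω i j ∂μ = 0 := by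
  have h1 : MeasurableSet {ω | A ω i j = 1} := hA.measurable i j (measurableSet_singleton 1)
  have h : (fun ω => A ω i j) =ᵐ[μ]
      fun ω => {ω | A ω i j = 1}.indicator (fun _ => (2 : ℝ)) ω - 1 := by
    filter_upwards [hA.ae_eq_one_or_eq_neg_one i j] with ω hω
    rcases hω with hω | hω <;> simp [Set.indicator, hω] <;> norm_num
  rw [integral_congr_ae h, integral_sub ((integrable_const _).indicator h1) (integrable_const _),
    integral_indicator_const _ h1, Measure.real, hA.prob_one]
  simp

lemma hasSubgaussianMGF_entry (hA : IsSymmetricBernoulli μ A) (i : Fin n) (j : Fin N) :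
    HasSubgaussianMGF (fun ω => A ω i j) 1 μ := by
  -- Hoeffding's lemma on [-1, 1]; half the length of the interval, squared, is 1.
  have := hasSubgaussianMGF_of_mem_Icc_of_integral_eq_zero (μ := μ) (X := fun ω => A ω i j)
    (a := -1) (b := 1) (hA.measurable i j).aemeasurable
    (by filter_upwards [hA.ae_eq_one_or_eq_neg_one i j] with ω hω
        rcases hω with hω | hω <;> simp [hω]) (hA.integral_entry i j)
  have e : ((‖(1 : ℝ) - -1‖₊ / 2) ^ 2 : NNReal) = 1 := by
    rw [← NNReal.coe_inj]
    push_cast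
    norm_num
  rwa [e] at this

lemma variance_entry (hA : IsSymmetricBernoulli μ A) (i : Fin n) (j : Fin N) :
    variance (fun ω => A ω i j) μ = 1 := by
  rw [variance_of_integral_eq_zero (hA.measurable i j).aemeasurable (hA.integral_entry i j)]
  have : (fun ω => A ω i j ^ 2) =ᵐ[μ] fun _ => 1 := by
    filter_upwards [hA.ae_eq_one_or_eq_neg_one i j] with ω hω
    rcases hω with hω | hω <;> simp [hω]
  rw [integral_congr_ae this]
  simp

variable {x : Fin N → ℝ}

/-- Independence is read off the joint law: a product measure over index pairs, curried, is the
product over rows of the product laws within each row. -/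
lemma iIndepFun_rows (hA : IsSymmetricBernoulli μ A) : iIndepFun (fun i ω j => A ω i j) μ := by
  have hm : ∀ i j, Measurable fun ω => A ω i j := hA.measurable
  have hp : ∀ i j, IsProbabilityMeasure (μ.map fun ω => A ω i j) :=
    fun i j => Measure.isProbabilityMeasure_map (hm i j).aemeasurable
  have hs : iIndepFun (fun (p : (_ : Fin n) × Fin N) ω => A ω p.1 p.2) μ :=
    hA.indep.precomp (Equiv.sigmaEquivProd (Fin n) (Fin N)).injective
  have hc : (MeasurableEquiv.piCurry fun (_ : Fin n) (_ : Fin N) => ℝ) ∘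
      (fun ω p => A ω p.1 p.2) = fun ω i j => A ω i j := by
    ext
    simp [Sigma.curry]
  rw [iIndepFun_iff_map_fun_eq_infinitePi_map (by fun_prop), ← hc,
    ← Measure.map_map (by fun_prop) (by fun_prop),
    (iIndepFun_iff_map_fun_eq_infinitePi_map (by fun_prop)).1 hs,
    Measure.infinitePi_map_piCurry (fun i j => μ.map fun ω => A ω i j)]
  congrm Measure.infinitePi fun i => ?_
  rw [(iIndepFun_iff_map_fun_eq_infinitePi_map (by fun_prop)).1 (hA.iIndepFun_row i)]

lemma iIndepFun_sum (hA : IsSymmetricBernoulli μ A) (x : Fin N → ℝ) :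
    iIndepFun (fun i ω => ∑ j, x j * A ω i j) μ :=
  hA.iIndepFun_rows.comp (fun i a => ∑ j, x j * a j) fun i => by fun_prop

lemma hasSubgaussianMGF_sum (hA : IsSymmetricBernoulli μ A) (hx : ∑ j, x j ^ 2 = 1) (i : Fin n) :
    HasSubgaussianMGF (fun ω => ∑ j, x j * A ω i j) 1 μ := by
  have := HasSubgaussianMGF.sum_of_iIndepFun (hA.iIndepFun_row_mul i x) (s := Finset.univ)
    fun j _ => (hA.hasSubgaussianMGF_entry i j).const_mul (x j)
  convert this using 1
  rw [← NNReal.coe_inj]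
  push_cast
  exact hx.symm.trans (Finset.sum_congr rfl fun j _ => (mul_one _).symm)

lemma integral_sum_sq (hA : IsSymmetricBernoulli μ A) (hx : ∑ j, x j ^ 2 = 1) (i : Fin n) :
    ∫ ω, (∑ j, x j * A ω i j) ^ 2 ∂μ = 1 := by
  have hm : ∀ i j, Measurable fun ω => A ω i j := hA.measurable
  have hp : ∀ j, HasSubgaussianMGF (fun ω => x j * A ω i j) _ μ :=
    fun j => (hA.hasSubgaussianMGF_entry i j).const_mul (x j)
  have h0 : ∫ ω, ∑ j, x j * A ω i j ∂μ = 0 := by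
    rw [integral_finsetSum _ fun j _ => (hp j).integrable]
    simp [integral_const_mul, hA.integral_entry]
  rw [← variance_of_integral_eq_zero (X := fun ω => ∑ j, x j * A ω i j)
    (Measurable.aemeasurable (by fun_prop)) h0]
  have h := IndepFun.variance_sum (μ := μ) (X := fun j ω => x j * A ω i j) (s := Finset.univ)
    (fun j _ => (hp j).memLp 2) fun j _ k _ hjk => (hA.iIndepFun_row_mul i x).indepFun hjk
  have e : (∑ j, fun ω => x j * A ω i j) = fun ω => ∑ j, x j * A ω i j := by
    ext ω
    simp
  rw [← e, h, ← hx]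
  refine Finset.sum_congr rfl fun j _ => ?_
  rw [variance_const_mul, hA.variance_entry, mul_one]

lemma measureReal_deviation_le (hA : IsSymmetricBernoulli μ A) (hx : ∑ j, x j ^ 2 = 1) {a : ℝ}
    (ha : 0 ≤ a) (ha1 : a ≤ 1) :
    μ.real {ω | a * n ≤ |∑ i, (∑ j, A ω i j * x j) ^ 2 - n|} ≤
      2 * Real.exp (-(a ^ 2 / 8192) * n) := by
  have hm : ∀ i j, Measurable fun ω => A ω i j := hA.measurable
  have := measureReal_abs_sum_sq_sub_one_ge_le (hA.iIndepFun_sum x) (fun i => by fun_prop)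
    (fun i => hA.hasSubgaussianMGF_sum hx i) (fun i => hA.integral_sum_sq hx i) ha ha1
  simpa [Finset.sum_sub_distrib, mul_comm] using this

end IsSymmetricBernoulli

/-! ### Nets of the unit sphere -/

section net

variable {E : Type*} [NormedAddCommGroup E] [NormedSpace ℝ E] [FiniteDimensional ℝ E]

open Metric Module in
-- Balls of radius 1/8 around the points are disjoint and lie in the ball of radius 9/8; comparing
-- volumes gives the base 9.
lemma card_le_of_separated_of_norm_eq_one (s : Finset E) (hs : ∀ c ∈ s, ‖c‖ = 1)
    (h : ∀ c ∈ s, ∀ d ∈ s, c ≠ d → 1 / 4 ≤ ‖c - d‖) : s.card ≤ 9 ^ finrank ℝ E := by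
  borelize E
  let ν : Measure E := Measure.addHaar
  have hdisj : Set.Pairwise (s : Set E) (Function.onFun Disjoint fun c => ball (c : E) (1 / 8)) := by
    intro c hc d hd hcd
    apply ball_disjoint_ball
    rw [dist_eq_norm]
    linarith [h c hc d hd hcd]
  have hsub : (⋃ c ∈ s, ball (c : E) (1 / 8)) ⊆ ball (0 : E) (9 / 8) := by
    refine Set.iUnion₂_subset fun x hx => ball_subset_ball' ?_
    rw [dist_zero_right, hs x hx]
    norm_num
  have hν : (s.card : ENNReal) * ENNReal.ofReal ((1 / 8) ^ finrank ℝ E) * ν (ball 0 1) ≤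
      ENNReal.ofReal ((9 / 8) ^ finrank ℝ E) * ν (ball 0 1) :=
    calc _ = ν (⋃ c ∈ s, ball (c : E) (1 / 8)) := by
          rw [measure_biUnion_finset hdisj fun c _ => measurableSet_ball]
          simp only [ν.addHaar_ball_of_pos _ (by norm_num : (0 : ℝ) < 1 / 8), Finset.sum_const,
            nsmul_eq_mul, mul_assoc]
      _ ≤ ν (ball (0 : E) (9 / 8)) := measure_mono hsub
      _ = _ := by simp only [ν.addHaar_ball_of_pos _ (by norm_num : (0 : ℝ) < 9 / 8)]
  have h₁ := (ENNReal.mul_le_mul_iff_left (measure_ball_pos ν (0 : E) zero_lt_one).ne'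
    measure_ball_lt_top.ne).1 hν
  have h₂ := ENNReal.toReal_le_of_le_ofReal (by positivity) h₁
  rw [ENNReal.toReal_mul, ENNReal.toReal_natCast, ENNReal.toReal_ofReal (by positivity),
    show (9 / 8 : ℝ) = 9 * (1 / 8) by norm_num, mul_pow, mul_le_mul_iff_left₀ (by positivity)] at h₂
  exact_mod_cast h₂

variable (E) in
open Module in
-- A separated set of maximal cardinality is a net, since an uncovered unit vector could be added to
-- it.
lemma exists_quarter_net : ∃ s : Finset E, (∀ y ∈ s, ‖y‖ = 1) ∧ s.card ≤ 9 ^ finrank ℝ E ∧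
    ∀ x : E, ‖x‖ = 1 → ∃ y ∈ s, ‖x - y‖ ≤ 1 / 4 := by
  classical
  let P : Finset E → Prop := fun s => (∀ y ∈ s, ‖y‖ = 1) ∧
    ∀ c ∈ s, ∀ d ∈ s, c ≠ d → 1 / 4 ≤ ‖c - d‖
  have hP : ∀ s, P s → s.card ≤ 9 ^ finrank ℝ E :=
    fun s hs => card_le_of_separated_of_norm_eq_one s hs.1 hs.2
  have hne : {k | ∃ s, P s ∧ s.card = k}.Nonempty := ⟨0, ∅, by simp [P], rfl⟩
  have hbdd : BddAbove {k | ∃ s, P s ∧ s.card = k} := by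
    refine ⟨9 ^ finrank ℝ E, ?_⟩
    rintro _ ⟨s, hs, rfl⟩
    exact hP s hs
  obtain ⟨s, hs, hcard⟩ := Nat.sSup_mem hne hbdd
  refine ⟨s, hs.1, hP s hs, fun x hx => ?_⟩
  by_contra! hfar
  have hxs : x ∉ s := fun hxs => by
    have := hfar x hxs
    simp at this
    linarith
  have hins : P (insert x s) := by
    constructor
    · intro y hy
      rcases Finset.mem_insert.1 hy with rfl | hy
      exacts [hx, hs.1 y hy]
    · intro c hc d hd hcd
      rcases Finset.mem_insert.1 hc with rfl | hc' <;>
        rcases Finset.mem_insert.1 hd with rfl | hd'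
      · exact absurd rfl hcd
      · exact (hfar d hd').le
      · rw [norm_sub_rev]
        exact (hfar c hc').le
      · exact hs.2 c hc' d hd' hcd
  have := le_csSup hbdd ⟨_, hins, rfl⟩
  rw [Finset.card_insert_of_notMem hxs, hcard] at this
  lia

end net

/-! ### From a net to the whole sphere. -/

section quadratic

variable {E F : Type*} [NormedAddCommGroup E] [InnerProductSpace ℝ E] [FiniteDimensional ℝ E]
  [NormedAddCommGroup F] [InnerProductSpace ℝ F]

lemma norm_sq_smul_sub_smul (a b : ℝ) (x y : F) :
    ‖a • x - b • y‖ ^ 2 = a ^ 2 * ‖x‖ ^ 2 - 2 * (a * b) * inner ℝ x y + b ^ 2 * ‖y‖ ^ 2 := by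
  rw [norm_sub_sq_real, norm_smul, norm_smul, mul_pow, mul_pow, Real.norm_eq_abs, Real.norm_eq_abs,
    sq_abs, sq_abs, real_inner_smul_left, real_inner_smul_right]
  ring

lemma abs_norm_sq_sub_norm_sq_le_of_net (L : E →ₗ[ℝ] F) {s : Finset E} (hs1 : ∀ y ∈ s, ‖y‖ = 1)
    (hs : ∀ x : E, ‖x‖ = 1 → ∃ y ∈ s, ‖x - y‖ ≤ 1 / 4) {η : ℝ}
    (h : ∀ y ∈ s, |‖L y‖ ^ 2 - ‖y‖ ^ 2| ≤ η) (x : E) :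
    |‖L x‖ ^ 2 - ‖x‖ ^ 2| ≤ 4 * η * ‖x‖ ^ 2 := by
  rcases eq_or_ne x 0 with rfl | hx
  · simp
  set q : E → ℝ := fun x => ‖L x‖ ^ 2 - ‖x‖ ^ 2 with hq
  have hsmul : ∀ (c : ℝ) z, q (c • z) = c ^ 2 * q z := fun c z => by
    simp only [hq, map_smul, norm_smul, mul_pow, Real.norm_eq_abs, sq_abs]
    ring
  have hcont : Continuous q := by
    have : Continuous L := L.continuous_of_finiteDimensional
    fun_prop
  have hxs : ‖x‖⁻¹ • x ∈ Metric.sphere (0 : E) 1 := by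
    simp [norm_smul, hx]
  have hproper : ProperSpace E := FiniteDimensional.proper ℝ E
  obtain ⟨z, hz, hmax⟩ := (isCompact_sphere (0 : E) 1).exists_isMaxOn ⟨_, hxs⟩
    (continuous_abs.comp hcont).continuousOn
  have hbound : ∀ w, |q w| ≤ |q z| * ‖w‖ ^ 2 := by
    intro w
    rcases eq_or_ne w 0 with rfl | hw
    · simp [hq]
    · have hw' : ‖w‖⁻¹ • w ∈ Metric.sphere (0 : E) 1 := by simp [norm_smul, hw]
      have := hmax hw'
      simp only [Set.mem_ofPred_eq, Function.comp_apply, hsmul, abs_mul] at this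
      have hw0 : 0 < ‖w‖ ^ 2 := by have := norm_pos_iff.2 hw; positivity
      rw [abs_of_pos (by rw [inv_pow]; positivity), inv_pow, inv_mul_le_iff₀ hw0] at this
      linarith
  have hz1 : ‖z‖ = 1 := by simpa using hz
  obtain ⟨y, hy, hzy⟩ := hs z hz1
  -- Polarization of q(z) - q(y) = B(z - y, z + y). The two vectors are 2(z - y) ± (z + y)/2:
  -- rescaling the short difference against the long sum keeps their squared norms at total at most
  -- 8/16 + 4/2 = 5/2.
  have hpol : q z = q y + (q ((5 / 2 : ℝ) • z - (3 / 2 : ℝ) • y) -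
      q ((3 / 2 : ℝ) • z - (5 / 2 : ℝ) • y)) / 4 := by
    simp only [hq, map_sub, map_smul, norm_sq_smul_sub_smul]
    ring
  have hn : ‖(5 / 2 : ℝ) • z - (3 / 2 : ℝ) • y‖ ^ 2 + ‖(3 / 2 : ℝ) • z - (5 / 2 : ℝ) • y‖ ^ 2 ≤
      5 / 2 := by
    have h₁ : ‖z - y‖ ^ 2 ≤ 1 / 16 := by
      have := pow_le_pow_left₀ (norm_nonneg _) hzy 2
      norm_num at this ⊢
      linarith
    rw [norm_sub_sq_real, hz1, hs1 y hy] at h₁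
    rw [norm_sq_smul_sub_smul, norm_sq_smul_sub_smul, hz1, hs1 y hy]
    linarith
  have hu := hbound ((5 / 2 : ℝ) • z - (3 / 2 : ℝ) • y)
  have hv := hbound ((3 / 2 : ℝ) • z - (5 / 2 : ℝ) • y)
  -- The maximum M of |q| on the sphere satisfies M ≤ η + 5M/8, so M ≤ 8η/3 ≤ 4η.
  have hzb : |q z| ≤ η + |q z| * (5 / 2) / 4 := by
    have hyb : |q y| ≤ η := h y hy
    have hM : |q z| * (‖(5 / 2 : ℝ) • z - (3 / 2 : ℝ) • y‖ ^ 2 +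
        ‖(3 / 2 : ℝ) • z - (5 / 2 : ℝ) • y‖ ^ 2) ≤ |q z| * (5 / 2) := by gcongr
    rw [abs_le] at hyb hu hv
    conv_lhs => rw [hpol]
    rw [abs_le]
    constructor <;> linarith
  refine (hbound x).trans ?_
  gcongr
  linarith [abs_nonneg (q z)]

end quadratic

/-! ### Random sign matrices have the restricted isometry property -/

lemma choose_le_exp_one_mul_div_pow {N m : ℕ} (hm : 1 ≤ m) :
    (N.choose m : ℝ) ≤ (Real.exp 1 * N / m) ^ m := by
  have hm' : (0 : ℝ) < m := by exact_mod_cast hm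
  have h₁ : (N.choose m : ℝ) ≤ (N : ℝ) ^ m / m.factorial := Nat.choose_le_pow_div m N
  have h₂ : (m : ℝ) ^ m / m.factorial ≤ Real.exp m := Real.pow_div_factorial_le_exp _ hm'.le m
  refine h₁.trans ?_
  rw [mul_div_assoc, mul_pow, div_pow, ← Real.exp_nat_mul, mul_one]
  calc (N : ℝ) ^ m / m.factorial = (m : ℝ) ^ m / m.factorial * ((N : ℝ) ^ m / (m : ℝ) ^ m) := by
        field_simp
    _ ≤ _ := by gcongr

lemma realIsometryOn_of_euclideanSpace {Φ : Matrix (Fin n) (Fin N) ℝ} {T : Finset (Fin N)} {t : ℝ}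
    (h : ∀ y : EuclideanSpace ℝ T,
      |‖Matrix.toEuclideanLin (Φ.submatrix id (fun i : T => (i : Fin N))) y‖ ^ 2 - ‖y‖ ^ 2| ≤
        t * ‖y‖ ^ 2) : RealIsometryOn Φ T t := by
  intro a ha
  have h₁ : ∑ j, a j ^ 2 = ∑ i : T, a i ^ 2 :=
    sum_of_support_subset fun i hi => by simp [ha i hi]
  have h₂ : ∀ r, ∑ j, Φ r j * a j = ∑ i : T, Φ r i * a i := fun r =>
    sum_of_support_subset fun i hi => by simp [ha i hi]
  have := h (WithLp.toLp 2 fun i => a i)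
  simp only [EuclideanSpace.norm_sq_eq, Matrix.toLpLin_apply, Matrix.mulVec, dotProduct,
    Matrix.submatrix_apply, id, Real.norm_eq_abs, sq_abs] at this
  simpa only [h₁, h₂] using this

lemma normalized_eq_map (B : Matrix (Fin n) (Fin N) ℝ) :
    normalized B = (B.map fun a => a / Real.sqrt n).map fun a => (a : ℂ) := rfl

lemma abs_div_sub_one_le_of_abs_sub_le {S : ℝ} {a : ℝ} (hn : 0 < n) (h : |S - n| ≤ a * n) :
    |S / n - 1| ≤ a := by
  have hn' : (0 : ℝ) < n := by exact_mod_cast hn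
  rwa [abs_div_sub_one_le_iff hn']

section random

variable {Ω : Type*} [MeasurableSpace Ω] {μ : Measure Ω} [IsProbabilityMeasure μ]
  {A : Ω → Matrix (Fin n) (Fin N) ℝ}

/-- Subadditivity replaces the complement rule, so no measurability of the RIP event is needed. -/
lemma one_sub_le_measureReal_of_compl_subset {G B : Set Ω} (h : Gᶜ ⊆ B) {b : ℝ}
    (hB : μ.real B ≤ b) : 1 - b ≤ μ.real G := by
  have h₁ : μ.real Set.univ ≤ μ.real (G ∪ B) := measureReal_mono fun ω _ => by
    by_cases hω : ω ∈ G
    exacts [Or.inl hω, Or.inr (h hω)]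
  have h₂ := measureReal_union_le (μ := μ) G B
  rw [probReal_univ] at h₁
  linarith

/-- With the exception of an event of small probability, all the matrices of `m` columns are near
isometries. -/
lemma measureReal_hasRIP_ge_sub_card (hA : IsSymmetricBernoulli μ A) {m : ℕ} (hn : 0 < n)
    (hmN : m ≤ N) {ε : ℝ} (hε : 0 ≤ ε) (hε1 : ε ≤ 1) :
    1 - (N.choose m : ℝ) * 9 ^ m * (2 * Real.exp (-(ε ^ 2 / 2 ^ 19) * n)) ≤
      μ.real {ω | HasRIP (normalized (A ω)) m (ε / 2)} := by
  classical
  have hn' : (0 : ℝ) < n := by exact_mod_cast hn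
  choose net hnet1 hnetcard hnet using fun T : Finset (Fin N) =>
    exists_quarter_net (EuclideanSpace ℝ T)
  let v : (T : Finset (Fin N)) → EuclideanSpace ℝ T → Fin N → ℝ :=
    fun T y i => if h : i ∈ T then y ⟨i, h⟩ else 0
  have hv : ∀ T y (f : Fin N → ℝ), ∑ j, f j * v T y j = ∑ i : T, f i * y i := by
    intro T y f
    rw [sum_of_support_subset (T := T) fun i hi => by simp [v, hi]]
    simp [v]
  have hv2 : ∀ T y, y ∈ net T → ∑ j, v T y j ^ 2 = 1 := by
    intro T y hy
    rw [sum_of_support_subset (T := T) fun i hi => by simp [v, hi]]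
    have := EuclideanSpace.norm_sq_eq y
    rw [hnet1 T y hy] at this
    simpa [v] using this.symm
  -- Deviation ε/8 on the net becomes ε/2 on the sphere, as passing to the sphere costs a factor 4.
  let bad : (T : Finset (Fin N)) → EuclideanSpace ℝ T → Set Ω := fun T y =>
    {ω | ε / 8 * n ≤ |∑ i, (∑ j, A ω i j * v T y j) ^ 2 - n|}
  have hbad : ∀ T, ∀ y ∈ net T, μ.real (bad T y) ≤ 2 * Real.exp (-(ε ^ 2 / 2 ^ 19) * n) := by
    intro T y hy
    have := hA.measureReal_deviation_le (hv2 T y hy) (a := ε / 8) (by positivity) (by linarith)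
    rwa [show (ε / 8) ^ 2 / 8192 = ε ^ 2 / 2 ^ 19 by ring] at this
  refine one_sub_le_measureReal_of_compl_subset
    (B := ⋃ T ∈ Finset.univ.powersetCard m, ⋃ y ∈ net T, bad T y) ?_ ?_
  · intro ω hω
    by_contra hgood
    refine hω ?_
    simp only [Set.mem_iUnion, not_exists, Finset.mem_powersetCard, Finset.subset_univ,
      true_and] at hgood
    refine hasRIP_of_card_eq hmN fun T hT => ?_
    rw [normalized_eq_map, isometryOn_map_iff]
    refine realIsometryOn_of_euclideanSpace fun y => ?_
    have := abs_norm_sq_sub_norm_sq_le_of_net (Matrix.toEuclideanLin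
      (((A ω).map fun a => a / Real.sqrt n).submatrix id (fun i : T => (i : Fin N))))
      (hnet1 T) (hnet T) (η := ε / 8) (fun z hz => ?_) y
    · rwa [show 4 * (ε / 8) = ε / 2 by ring] at this
    · have hz' : |∑ i, (∑ j, A ω i j * v T z j) ^ 2 - n| ≤ ε / 8 * n :=
        (not_le.1 (hgood T hT z hz)).le
      have e : ‖Matrix.toEuclideanLin (((A ω).map fun a => a / Real.sqrt n).submatrix id
          (fun i : T => (i : Fin N))) z‖ ^ 2 = (∑ i, (∑ j, A ω i j * v T z j) ^ 2) / n := by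
        rw [EuclideanSpace.norm_sq_eq, Finset.sum_div]
        refine Finset.sum_congr rfl fun r _ => ?_
        rw [hv, Real.norm_eq_abs, sq_abs]
        simp only [Matrix.toLpLin_apply, Matrix.mulVec, dotProduct, Matrix.submatrix_apply, id,
          Matrix.map_apply, div_mul_eq_mul_div]
        rw [← Finset.sum_div, div_pow, Real.sq_sqrt hn'.le]
      rw [e, hnet1 T z hz, one_pow]
      exact abs_div_sub_one_le_of_abs_sub_le hn hz'
  · calc _ ≤ ∑ T ∈ Finset.univ.powersetCard m, ∑ y ∈ net T, μ.real (bad T y) :=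
          (measureReal_biUnion_finset_le _ _).trans
            (Finset.sum_le_sum fun T _ => measureReal_biUnion_finset_le _ _)
      _ ≤ ∑ T ∈ Finset.univ.powersetCard m,
            9 ^ m * (2 * Real.exp (-(ε ^ 2 / 2 ^ 19) * n)) := by
          refine Finset.sum_le_sum fun T hT => ?_
          have hcard : ((net T).card : ℝ) ≤ 9 ^ m := by
            have := hnetcard T
            rw [finrank_euclideanSpace, Fintype.card_coe, (Finset.mem_powersetCard.1 hT).2] at this
            exact_mod_cast this
          refine (Finset.sum_le_sum fun y hy => hbad T y hy).trans ?_
          rw [Finset.sum_const, nsmul_eq_mul]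
          gcongr
      _ = _ := by
          rw [Finset.sum_const, Finset.card_powersetCard, Finset.card_univ, Fintype.card_fin,
            nsmul_eq_mul, mul_assoc]

lemma one_le_log_exp_one_mul_div {m : ℕ} (hm : 1 ≤ m) (hmN : m ≤ N) :
    1 ≤ Real.log (Real.exp 1 * N / m) := by
  have hm' : (0 : ℝ) < m := by exact_mod_cast hm
  have hmN' : (m : ℝ) ≤ N := by exact_mod_cast hmN
  rw [Real.le_log_iff_exp_le (by have := hm'.trans_le hmN'; positivity), le_div_iff₀ hm']
  gcongr

/-- The subsets and the nets cost exp(4mℓ) in the union bound, which the hypothesis on n bounds by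
exp(ε²n/2²²); the rate 2⁻¹⁹ thus stays above 2⁻²⁰. The halved parameter is what certification needs
later. -/
theorem measureReal_hasRIP_half_ge (hA : IsSymmetricBernoulli μ A) {m : ℕ} (hm : 1 ≤ m)
    (hmN : m ≤ N) {ε : ℝ} (hε : 0 < ε) (hε1 : ε ≤ 1)
    (hn : 2 ^ 24 * ε⁻¹ ^ 2 * m * Real.log (Real.exp 1 * N / m) ≤ n) :
    1 - 2 * Real.exp (-(1 / 2 ^ 20 * ε ^ 2 * n)) ≤
      μ.real {ω | HasRIP (normalized (A ω)) m (ε / 2)} := by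
  have hm' : (0 : ℝ) < m := by exact_mod_cast hm
  have hN' : (0 : ℝ) < N := by exact_mod_cast hm.trans hmN
  set ℓ := Real.log (Real.exp 1 * N / m) with hℓ
  have hℓ1 : 1 ≤ ℓ := one_le_log_exp_one_mul_div hm hmN
  have hn0 : (0 : ℝ) < n := lt_of_lt_of_le (by positivity) hn
  refine le_trans ?_ (measureReal_hasRIP_ge_sub_card hA (by exact_mod_cast hn0) hmN hε.le hε1)
  have h₁ : (N.choose m : ℝ) ≤ Real.exp (m * ℓ) := by
    rw [mul_comm, Real.exp_mul, hℓ, Real.exp_log (by positivity), Real.rpow_natCast]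
    exact choose_le_exp_one_mul_div_pow hm
  have h₂ : (9 : ℝ) ^ m ≤ Real.exp (3 * m * ℓ) := by
    have h9 : (9 : ℝ) ≤ Real.exp 3 := by
      have := Real.add_one_le_exp (1 : ℝ)
      have h3 : Real.exp 3 = Real.exp 1 ^ 3 := by rw [← Real.exp_nat_mul]; norm_num
      have := Real.exp_one_gt_d9
      rw [h3]
      nlinarith [pow_le_pow_left₀ (by norm_num) (by linarith : (2.7 : ℝ) ≤ Real.exp 1) 3]
    calc (9 : ℝ) ^ m ≤ Real.exp 3 ^ m := by gcongr
      _ = Real.exp (m * 3) := (Real.exp_nat_mul 3 m).symm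
      _ ≤ _ := Real.exp_le_exp.2 (by nlinarith)
  have h₃ : 4 * m * ℓ ≤ ε ^ 2 * n / 2 ^ 22 := by
    have := mul_le_mul_of_nonneg_left hn (sq_nonneg ε)
    have e : ε ^ 2 * (2 ^ 24 * ε⁻¹ ^ 2 * m * ℓ) = 2 ^ 24 * m * ℓ := by field_simp
    rw [e] at this
    linarith
  rw [sub_le_sub_iff_left]
  calc (N.choose m : ℝ) * 9 ^ m * (2 * Real.exp (-(ε ^ 2 / 2 ^ 19) * n))
      ≤ Real.exp (m * ℓ) * Real.exp (3 * m * ℓ) * (2 * Real.exp (-(ε ^ 2 / 2 ^ 19) * n)) := by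
        gcongr
    _ = 2 * Real.exp (m * ℓ + 3 * m * ℓ + -(ε ^ 2 / 2 ^ 19) * n) := by
        rw [Real.exp_add, Real.exp_add]
        ring
    _ ≤ _ := by
        gcongr
        have : 0 ≤ ε ^ 2 * n := by positivity
        linarith

lemma HasRIP.mono {Φ : Matrix (Fin n) (Fin N) ℂ} {k : ℕ} {s t : ℝ} (h : HasRIP Φ k s)
    (hst : s ≤ t) : HasRIP Φ k t := by
  rw [hasRIP_iff_isometryOn] at h ⊢
  exact fun T hT => (h T hT).mono le_rfl hst

lemma HasRIP.ripParameter_le {Φ : Matrix (Fin n) (Fin N) ℂ} {m : ℕ} {t : ℝ} (h : HasRIP Φ m t)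
    (ht : 0 ≤ t) : ripParameter Φ m ≤ t :=
  (ripParameter_le_iff ht).2 fun T hT => hasRIP_iff_isometryOn.1 h T hT.le

theorem measureReal_hasRIP_ge (hA : IsSymmetricBernoulli μ A) {m : ℕ} (hm : 1 ≤ m)
    (hmN : m ≤ N) {ε : ℝ} (hε : 0 < ε) (hε1 : ε ≤ 1)
    (hn : 2 ^ 24 * ε⁻¹ ^ 2 * m * Real.log (Real.exp 1 * N / m) ≤ n) :
    1 - 2 * Real.exp (-(1 / 2 ^ 20 * ε ^ 2 * n)) ≤
      μ.real {ω | HasRIP (normalized (A ω)) m ε} :=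
  (measureReal_hasRIP_half_ge hA hm hmN hε hε1 hn).trans
    (measureReal_mono fun _ h => h.mono (by linarith))

theorem measureReal_lazyCertifies_ge (hA : IsSymmetricBernoulli μ A) {m : ℕ} (hm : 2 ≤ m)
    (hmN : m ≤ N) {δ : ℝ} (hδ : 0 < δ) (hδ1 : δ < 1) :
    1 - 2 * (Real.exp 1 * N / m) ^ (-(16 * m) : ℝ) ≤
      μ.real {ω | ∀ k : ℕ, m ≤ k →
        (k : ℝ) ≤ δ * Real.sqrt (m * n / (2 ^ 24 * Real.log (Real.exp 1 * N / m))) →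
        LazyCertifies (normalized (A ω)) m δ k} := by
  have hm2 : (2 : ℝ) ≤ m := by exact_mod_cast hm
  have hm' : (0 : ℝ) < m := by linarith
  have hN' : (0 : ℝ) < N := by exact_mod_cast (zero_lt_two.trans_le hm).trans_le hmN
  set ℓ := Real.log (Real.exp 1 * N / m) with hℓ
  have hℓ1 : 1 ≤ ℓ := one_le_log_exp_one_mul_div (by lia) hmN
  -- If the upper limit for k lies below m, no k is concerned and the event is everything.
  by_cases hk : (m : ℝ) ≤ δ * Real.sqrt (m * n / (2 ^ 24 * ℓ))
  · have hn0 : (0 : ℝ) < n := by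
      rcases (Nat.cast_nonneg n : (0 : ℝ) ≤ n).eq_or_lt with h | h
      · rw [← h] at hk
        simp at hk
        linarith
      · exact h
    -- The smallest ε for which n is large enough; then the limit for k is δm/ε, and k ≥ m forces ε
    -- ≤ δ.
    set ε := Real.sqrt (2 ^ 24 * ℓ * m / n) with hεdef
    have hε : 0 < ε := Real.sqrt_pos.2 (by positivity)
    have hε2 : ε ^ 2 = 2 ^ 24 * ℓ * m / n := Real.sq_sqrt (by positivity)
    have hsqrt : Real.sqrt (m * n / (2 ^ 24 * ℓ)) = m / ε := by
      rw [Real.sqrt_eq_iff_eq_sq (by positivity) (by positivity), div_pow, hε2]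
      field_simp
    rw [hsqrt] at hk ⊢
    have hεδ : ε ≤ δ := by
      rw [← mul_div_assoc, le_div_iff₀ hε] at hk
      nlinarith
    have hn : 2 ^ 24 * ε⁻¹ ^ 2 * m * ℓ ≤ n := by
      rw [inv_pow, hε2]
      apply le_of_eq
      field_simp
    have hmain := measureReal_hasRIP_half_ge hA (by lia) hmN hε (hεδ.trans hδ1.le) hn
    have hexp : Real.exp (-(1 / 2 ^ 20 * ε ^ 2 * n)) =
        (Real.exp 1 * N / m) ^ (-(16 * m) : ℝ) := by
      rw [Real.rpow_def_of_pos (by positivity), ← hℓ, hε2]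
      congr 1
      field_simp
      norm_num
    rw [hexp] at hmain
    refine hmain.trans (measureReal_mono fun ω hω k hmk hkδ => ⟨hmk, ?_⟩)
    have hrip := HasRIP.ripParameter_le (hω : HasRIP (normalized (A ω)) m (ε / 2)) (by positivity)
    have hk1 : (m : ℝ) ≤ k := by exact_mod_cast hmk
    rw [← mul_div_assoc, le_div_iff₀ hε] at hkδ
    rw [div_le_iff₀ (by linarith)]
    calc _ ≤ ε / 2 * ((k : ℝ) - 1) := by
          have : 0 ≤ (k : ℝ) - 1 := by linarith
          gcongr
      -- From εk ≤ δm and m ≤ 2(m - 1): the factor lost between k/m and (k - 1)/(m - 1) is made up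
      -- by the parameter ε/2.
      _ ≤ δ * (m - 1) := by nlinarith
  · have : {ω | ∀ k : ℕ, m ≤ k → (k : ℝ) ≤ δ * Real.sqrt (m * n / (2 ^ 24 * ℓ)) →
        LazyCertifies (normalized (A ω)) m δ k} = Set.univ := by
      refine Set.eq_univ_of_forall fun ω k hmk hkδ => absurd ?_ hk
      exact le_trans (by exact_mod_cast hmk) hkδ
    rw [this, probReal_univ]
    have : 0 ≤ (Real.exp 1 * N / m) ^ (-(16 * m) : ℝ) := by positivity
    linarith

end random

/-! ### Numbers of steps -/

section time

lemma bind_time {α β : Type} (x : Timed α) (f : α → Timed β) :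
    (x >>= f).time = x.time + (f x.val).time := rfl

lemma step_time {α : Type} (a : α) : (step a).time = 1 := rfl

lemma tabulate_time_le {d B : ℕ} {f : Fin d → Fin d → Timed ℝ} (h : ∀ i j, (f i j).time ≤ B) :
    (tabulate f).time ≤ d ^ 2 * (B + 1) := by
  calc (tabulate f).time ≤ ∑ _i : Fin d, ∑ _j : Fin d, (B + 1) := by
        change ∑ i, ∑ j, ((f i j).time + 1) ≤ _
        exact Finset.sum_le_sum fun i _ => Finset.sum_le_sum fun j _ => Nat.succ_le_succ (h i j)
    _ = _ := by
        simp only [Finset.sum_const, Finset.card_univ, Fintype.card_fin, smul_eq_mul]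
        ring

lemma allLoop_time_le {ι : Type} {B : ℕ} {f : ι → Timed Bool} (l : List ι)
    (h : ∀ i, (f i).time ≤ B) : (allLoop f l).time ≤ B * l.length + 1 := by
  induction l with
  | nil => simp [allLoop, step_time]
  | cons i l ih =>
    rw [allLoop, bind_time, List.length_cons, mul_add]
    have := h i
    split_ifs
    · lia
    · rw [step_time]
      lia

lemma sumLoop_time_le {ι : Type} {B : ℕ} {f : ι → Timed ℝ} (l : List ι)
    (h : ∀ i, (f i).time ≤ B) : (sumLoop f l).time ≤ (B + 1) * l.length + 1 := by
  induction l with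
  | nil => simp [sumLoop, step_time]
  | cons i l ih =>
    rw [sumLoop, bind_time, bind_time, List.length_cons, mul_add]
    have := h i
    have : ∀ x y : ℝ, (add x y).time = 1 := fun _ _ => rfl
    rw [this]
    lia

lemma filterLoop_time_le {ι : Type} {B : ℕ} {f : ι → Timed Bool} (l : List ι)
    (h : ∀ i, (f i).time ≤ B) : (filterLoop f l).time ≤ (B + 1) * l.length + 1 := by
  induction l with
  | nil => simp [filterLoop, step_time]
  | cons i l ih =>
    rw [filterLoop, bind_time, bind_time, List.length_cons, mul_add]
    have := h i
    split_ifs <;> rw [step_time] <;> lia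

/-- Each elimination round fills a d × d table at 4 steps per entry at most, and the increment of
4d³ covers this with the lower-order work. -/
lemma psdTest_time_le (d : ℕ) (M : Matrix (Fin d) (Fin d) ℝ) :
    (psdTest d M).time ≤ 4 * d ^ 3 + 1 := by
  induction d with
  | zero => simp [psdTest, step_time]
  | succ d ih =>
    have hlt : ∀ x y : ℝ, (lt x y).time = 1 := fun _ _ => rfl
    have heq : ∀ x y : ℝ, (eq x y).time = 1 := fun _ _ => rfl
    have hcube : 4 * (d + 1) ^ 3 = 4 * d ^ 3 + 12 * d ^ 2 + 12 * d + 4 := by ring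
    rw [psdTest, bind_time, hlt]
    split_ifs
    · rw [step_time]
      lia
    · rw [bind_time, heq]
      split_ifs
      · rw [bind_time]
        have h₁ := allLoop_time_le (f := fun j : Fin d => eq (M 0 j.succ) 0) (B := 1)
          (List.finRange d) fun _ => le_rfl
        rw [List.length_finRange] at h₁
        split_ifs
        · rw [bind_time]
          have h₂ := tabulate_time_le (f := fun i j : Fin d => step (M i.succ j.succ)) (B := 1)
            fun _ _ => le_rfl
          have h₃ := ih (tabulate fun i j : Fin d => step (M i.succ j.succ)).val
          lia
        · rw [step_time]
          lia
      · rw [bind_time]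
        refine (Nat.add_le_add_left (Nat.add_le_add_left (Nat.add_le_add
          (tabulate_time_le (B := 3) fun _ _ => le_rfl) (ih _)) _) _).trans ?_
        lia

lemma subsetTest_time_le {n N : ℕ} (Φ : Matrix (Fin n) (Fin N) ℝ) (t : ℝ) (l : List (Fin N)) :
    (subsetTest Φ t l).time ≤
      10 * l.length ^ 3 + 4 * n * l.length ^ 2 + 8 * l.length ^ 2 + 3 := by
  rw [subsetTest, bind_time, bind_time, bind_time, bind_time, bind_time, step_time]
  have hfetch : ∀ i : Fin l.length, (fetch l i).time ≤ l.length := fun i => i.2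
  refine (Nat.add_le_add (tabulate_time_le (B := 2 * l.length + (4 * n + 1)) fun i j => ?_)
    (Nat.add_le_add (tabulate_time_le (B := 2) fun i j => ?_)
    (Nat.add_le_add (tabulate_time_le (B := 2) fun i j => ?_)
    (Nat.add_le_add (psdTest_time_le _ _) (Nat.add_le_add_right (psdTest_time_le _ _) _))))).trans ?_
  · rw [bind_time, bind_time]
    refine (Nat.add_le_add (hfetch _) (Nat.add_le_add (hfetch _)
      (sumLoop_time_le (B := 3) _ fun _ => le_rfl))).trans ?_
    rw [List.length_finRange]
    lia
  · split_ifs <;> exact le_rfl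
  · split_ifs <;> exact le_rfl
  · apply le_of_eq
    ring

/-- The + 1 on the left absorbs the final conjunction, so the recursion adds exactly as in Pascal's
rule, and (x + 1)^m + (x + 1)^(m + 1) ≤ (x + 2)^(m + 1) closes the induction. -/
lemma allSubsets_time_le {α : Type} {test : List α → Timed Bool} {B : ℕ} (m : ℕ)
    (l chosen : List α)
    (h : ∀ s : List α, s.length = m + chosen.length → (test s).time ≤ B) :
    (allSubsets test m l chosen).time + 1 ≤ (B + 2) * (l.length + 1) ^ m := by
  induction l generalizing m chosen with
  | nil =>
    cases m with
    | zero =>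
      have := h chosen (by simp)
      simp [allSubsets]
      lia
    | succ m => simp [allSubsets, step_time]
  | cons a l ih =>
    cases m with
    | zero =>
      have := h chosen (by simp)
      simp [allSubsets]
      lia
    | succ m =>
      rw [allSubsets, bind_time, bind_time, step_time, List.length_cons]
      have h₁ := ih m (a :: chosen) fun s hs => h s (by rw [hs, List.length_cons]; lia)
      have h₂ := ih (m + 1) chosen h
      have h₃ : (l.length + 1) ^ m + (l.length + 1) ^ (m + 1) ≤ (l.length + 1 + 1) ^ (m + 1) := by
        calc _ = (l.length + 1) ^ m * (l.length + 1 + 1) := by ring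
          _ ≤ (l.length + 1 + 1) ^ m * (l.length + 1 + 1) := by gcongr; lia
          _ = _ := (pow_succ _ _).symm
      calc _ ≤ (B + 2) * ((l.length + 1) ^ m + (l.length + 1) ^ (m + 1)) := by
            rw [mul_add]
            lia
        _ ≤ _ := Nat.mul_le_mul_left _ h₃

lemma lazyProgram_time_le {n N m : ℕ} (Φ : Matrix (Fin n) (Fin N) ℝ) (δ : ℝ) (hn : n ≤ N)
    (hm : 2 ≤ m) (hmN : m ≤ N) : (lazyProgram Φ m δ).time ≤ N ^ (10 + 2 * m) := by
  have hN : 2 ≤ N := hm.trans hmN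
  have htest : ∀ t : ℝ, ∀ s : List (Fin N), s.length = m + ([] : List (Fin N)).length →
      (subsetTest Φ t s).time ≤ 25 * N ^ 3 := by
    intro t s hs
    refine (subsetTest_time_le Φ t s).trans ?_
    rw [hs, List.length_nil, add_zero]
    have h₁ : m ^ 3 ≤ N ^ 3 := by gcongr
    have h₂ : n * m ^ 2 ≤ N ^ 3 := by
      calc n * m ^ 2 ≤ N * N ^ 2 := by gcongr
        _ = _ := by ring
    have h₃ : m ^ 2 ≤ N ^ 3 := by
      calc m ^ 2 ≤ N ^ 2 := by gcongr
        _ ≤ N ^ 3 := Nat.pow_le_pow_right (by lia) (by lia)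
    have h₄ : 1 ≤ N ^ 3 := Nat.one_le_pow _ _ (by lia)
    rw [mul_assoc 4 n]
    lia
  have hsub : ∀ t : ℝ, (allSubsets (subsetTest Φ t) m (List.finRange N) []).time + 1 ≤
      27 * N ^ 3 * (N + 1) ^ m := by
    intro t
    refine (allSubsets_time_le m (List.finRange N) [] (htest t)).trans ?_
    rw [List.length_finRange]
    have h₄ : 1 ≤ N ^ 3 := Nat.one_le_pow _ _ (by lia)
    gcongr
    lia
  have hfilter := filterLoop_time_le (B := 27 * N ^ 3 * (N + 1) ^ m + 3) (f := fun k : ℕ => (do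
    let x ← sub (m : ℝ) 1
    let y ← mul δ x
    let z ← sub (k : ℝ) 1
    let t ← div y z
    allSubsets (subsetTest Φ t) m (List.finRange N) [] : Timed Bool)) (List.range' m (N + 1 - m))
    fun k => by
      have := hsub (δ * ((m : ℝ) - 1) / ((k : ℝ) - 1))
      change 1 + (1 + (1 + (1 + (allSubsets (subsetTest Φ (δ * ((m : ℝ) - 1) / ((k : ℝ) - 1))) m
        (List.finRange N) []).time))) ≤ _
      lia
  refine hfilter.trans ?_
  rw [List.length_range']
  have hX : 1 ≤ N ^ 3 * (N + 1) ^ m :=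
    Nat.one_le_iff_ne_zero.2 (by have : N ≠ 0 := by lia
                                 positivity)
  have h64 : 2 ^ 6 ≤ N ^ 6 := by gcongr
  calc (27 * N ^ 3 * (N + 1) ^ m + 3 + 1) * (N + 1 - m) + 1
      ≤ (31 * (N ^ 3 * (N + 1) ^ m)) * N + N ^ 3 * (N + 1) ^ m := by
        refine Nat.add_le_add (Nat.mul_le_mul ?_ (by lia)) hX
        rw [mul_assoc 27]
        lia
    _ ≤ (31 * (N ^ 3 * (N + 1) ^ m)) * N + N ^ 3 * (N + 1) ^ m * N :=
        Nat.add_le_add_left (Nat.le_mul_of_pos_right _ (by lia)) _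
    _ = 2 ^ 5 * N ^ 4 * (N + 1) ^ m := by ring
    _ ≤ N ^ 6 * N ^ 4 * (N ^ 2) ^ m := by
        have h₅ : N + 1 ≤ N ^ 2 := by nlinarith
        have h₆ : 2 ^ 5 ≤ N ^ 6 := by lia
        exact Nat.mul_le_mul (Nat.mul_le_mul_right _ h₆) (Nat.pow_le_pow_left h₅ m)
    _ = _ := by
        rw [← pow_mul]
        ring

end time

/-! ### The choice `m = (log N)³` -/

section logCube

variable {m : ℕ}

lemma cast_le_log_cube (hmdef : m = ⌊Real.log N ^ 3⌋₊) (hm : 2 ≤ m) :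
    (m : ℝ) ≤ Real.log N ^ 3 := by
  rw [hmdef] at hm ⊢
  refine Nat.floor_le ?_
  by_contra! h
  rw [Nat.floor_of_nonpos h.le] at hm
  lia

lemma log_cube_le_two_mul (hmdef : m = ⌊Real.log N ^ 3⌋₊) (hm : 2 ≤ m) :
    Real.log N ^ 3 ≤ 2 * m := by
  have h : Real.log N ^ 3 < m + 1 := by
    rw [hmdef]
    exact Nat.lt_floor_add_one _
  have : (2 : ℝ) ≤ m := by exact_mod_cast hm
  linarith

lemma one_le_log_of_floor (hmdef : m = ⌊Real.log N ^ 3⌋₊) (hm : 2 ≤ m) : 1 ≤ Real.log N := by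
  have h := cast_le_log_cube hmdef hm
  have hm2 : (2 : ℝ) ≤ m := by exact_mod_cast hm
  by_contra! hlt
  have := pow_le_one₀ (n := 3) (Real.log_natCast_nonneg N) hlt.le
  linarith

theorem lazyProgram_time_le_rpow {n : ℕ} (Φ : Matrix (Fin n) (Fin N) ℝ) (δ : ℝ) (hn : n ≤ N)
    (hmdef : m = ⌊Real.log N ^ 3⌋₊) (hm : 2 ≤ m) (hmN : m ≤ N) :
    ((lazyProgram Φ m δ).time : ℝ) ≤ 2 ^ (14 * Real.log N ^ 4) := by
  have h₁ : ((lazyProgram Φ m δ).time : ℝ) ≤ (N : ℝ) ^ (10 + 2 * m) := by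
    exact_mod_cast lazyProgram_time_le Φ δ hn hm hmN
  have hN : (0 : ℝ) < N := by exact_mod_cast (zero_lt_two.trans_le hm).trans_le hmN
  have hu := one_le_log_of_floor hmdef hm
  have hmu := cast_le_log_cube hmdef hm
  have hm2 : (2 : ℝ) ≤ m := by exact_mod_cast hm
  refine h₁.trans ?_
  rw [← Real.rpow_natCast, Real.rpow_def_of_pos hN, Real.rpow_def_of_pos two_pos, Real.exp_le_exp]
  push_cast
  set u := Real.log N
  -- Since u³ ≥ m ≥ 2, the constant 10 is at most 5u³. Passing to base 2 turns 7 into at most 14, as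
  -- log 2 > 1/2.
  have h₂ : u * (10 + 2 * m) ≤ u * (7 * u ^ 3) := by
    gcongr
    linarith
  have h₃ : 0 ≤ u ^ 4 := by positivity
  nlinarith [Real.log_two_gt_d9]

lemma log_exp_one_mul_div (hm : 1 ≤ m) (hmN : m ≤ N) :
    Real.log (Real.exp 1 * N / m) = 1 + Real.log N - Real.log m := by
  have hm' : (m : ℝ) ≠ 0 := by have := hm; positivity
  have hN' : (N : ℝ) ≠ 0 := by have := hm.trans hmN; positivity
  rw [Real.log_div (by positivity) hm', Real.log_mul (Real.exp_pos 1).ne' hN', Real.log_exp]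

/-- Shrinking by m costs only about 3 log log N. The tangent to the logarithm at 8 handles log N ≥
8, and below that the bound 1 on the right suffices. -/
lemma log_div_eight_le (hmdef : m = ⌊Real.log N ^ 3⌋₊) (hm : 2 ≤ m) (hmN : m ≤ N) :
    Real.log N / 8 ≤ Real.log (Real.exp 1 * N / m) := by
  have hu := one_le_log_of_floor hmdef hm
  have hmu := cast_le_log_cube hmdef hm
  have h1 := one_le_log_exp_one_mul_div (N := N) (m := m) (by lia) hmN
  rw [log_exp_one_mul_div (by lia) hmN] at h1 ⊢
  have hm' : (0 : ℝ) < m := by exact_mod_cast (by lia : 0 < m)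
  set u := Real.log N
  have h₁ : Real.log m ≤ 3 * Real.log u := by
    calc Real.log m ≤ Real.log (u ^ 3) := Real.log_le_log hm' hmu
      _ = _ := by rw [Real.log_pow]; norm_num
  have h₂ : Real.log u ≤ 3 * Real.log 2 + (u / 8 - 1) := by
    have h8 : u = 2 ^ 3 * (u / 8) := by ring
    have := Real.log_le_sub_one_of_pos (by positivity : 0 < u / 8)
    calc Real.log u = Real.log (2 ^ 3 * (u / 8)) := by rw [← h8]
      _ = 3 * Real.log 2 + Real.log (u / 8) := by
        rw [Real.log_mul (by norm_num) (by positivity), Real.log_pow]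
        norm_num
      _ ≤ _ := by linarith
  have h₃ := Real.log_two_lt_d9
  rcases le_total u 8 with h | h <;> linarith

variable {Ω : Type*} [MeasurableSpace Ω] {μ : Measure Ω} [IsProbabilityMeasure μ]
  {A : Ω → Matrix (Fin n) (Fin N) ℝ}

theorem measureReal_lazyCertifies_log_cube_ge (hA : IsSymmetricBernoulli μ A)
    (hmdef : m = ⌊Real.log N ^ 3⌋₊) (hm : 2 ≤ m) (hmN : m ≤ N) {δ : ℝ} (hδ : 0 < δ)
    (hδ1 : δ < 1) :
    1 - 2 ^ (-(1 / 2 * Real.log N ^ 4)) ≤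
      μ.real {ω | ∀ k : ℕ, m ≤ k → (k : ℝ) ≤ 1 / 2 ^ 13 * δ * Real.log N * Real.sqrt n →
        LazyCertifies (normalized (A ω)) m δ k} := by
  have hu := one_le_log_of_floor hmdef hm
  have hmu := cast_le_log_cube hmdef hm
  have hum := log_cube_le_two_mul hmdef hm
  have hℓ1 := one_le_log_exp_one_mul_div (N := N) (m := m) (by lia) hmN
  have hℓ8 := log_div_eight_le hmdef hm hmN
  have hm2 : (2 : ℝ) ≤ m := by exact_mod_cast hm
  have hN : (0 : ℝ) < N := by exact_mod_cast (zero_lt_two.trans_le hm).trans_le hmN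
  have hℓ2 : Real.log (Real.exp 1 * N / m) ≤ 2 * Real.log N := by
    rw [log_exp_one_mul_div (by lia) hmN]
    linarith [Real.log_nonneg (by linarith : (1 : ℝ) ≤ m)]
  have hmain := measureReal_lazyCertifies_ge hA hm hmN hδ hδ1
  refine le_trans ?_ (hmain.trans (measureReal_mono fun ω hω k hmk hk => hω k hmk (hk.trans ?_)))
  · rw [sub_le_sub_iff_left, Real.rpow_def_of_pos (by positivity), Real.rpow_def_of_pos two_pos]
    set ℓ := Real.log (Real.exp 1 * N / m)
    set u := Real.log N
    calc 2 * Real.exp (ℓ * -(16 * m)) = Real.exp (Real.log 2 + ℓ * -(16 * m)) := by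
          rw [Real.exp_add, Real.exp_log two_pos]
      _ ≤ _ := by
          refine Real.exp_le_exp.2 ?_
          -- From u³ ≤ 2m and u/8 ≤ ℓ; the failure exponent 16mℓ therefore exceeds u⁴, with room for
          -- the prefactor 2.
          have h₁ : u ^ 4 ≤ 16 * m * ℓ := by
            calc u ^ 4 = 8 * u ^ 3 * (u / 8) := by ring
              _ ≤ 8 * (2 * m) * ℓ := by gcongr
              _ = _ := by ring
          have h₂ : 2 ≤ u ^ 4 := by
            calc (2 : ℝ) ≤ u ^ 3 := by linarith
              _ ≤ u ^ 4 := pow_le_pow_right₀ hu (by lia)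
          have h₃ := Real.log_two_lt_d9
          nlinarith
  · set ℓ := Real.log (Real.exp 1 * N / m)
    set u := Real.log N
    have hn : (0 : ℝ) ≤ n := Nat.cast_nonneg n
    have h₁ : 1 / 2 ^ 13 * u * Real.sqrt n ≤ Real.sqrt (m * n / (2 ^ 24 * ℓ)) := by
      refine Real.le_sqrt_of_sq_le ?_
      rw [mul_pow, Real.sq_sqrt hn, le_div_iff₀ (by positivity)]
      -- The factor 4 fixes K = 2⁻¹³, because 2²⁴ K² = 1/4.
      have h₂ : u ^ 2 * ℓ ≤ 4 * m := by
        calc u ^ 2 * ℓ ≤ u ^ 2 * (2 * u) := by gcongr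
          _ = 2 * u ^ 3 := by ring
          _ ≤ 4 * m := by linarith
      calc (1 / 2 ^ 13 * u) ^ 2 * n * (2 ^ 24 * ℓ) = (u ^ 2 * ℓ) * (n : ℝ) / 4 := by ring
        _ ≤ (4 * m : ℝ) * (n : ℝ) / 4 := by gcongr
        _ = _ := by ring
    calc 1 / 2 ^ 13 * δ * u * Real.sqrt n = δ * (1 / 2 ^ 13 * u * Real.sqrt n) := by ring
      _ ≤ _ := by gcongr

end logCube

end LazyRIP

end

theorem proposition2 :
    -- what the algorithm certifies is correct
    (∀ (n N m k : ℕ) (δ : ℝ) (Φ : Matrix (Fin n) (Fin N) ℂ), 2 ≤ m → m ≤ N → 0 < δ → δ < 1 →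
      LazyRIP.UnitColumns Φ → LazyRIP.LazyCertifies Φ m δ k → LazyRIP.HasRIP Φ k δ) ∧
    -- the step-counted program carries out the algorithm
    (∀ (n N m : ℕ) (δ : ℝ) (Φ : Matrix (Fin n) (Fin N) ℝ), 2 ≤ m → m ≤ N → 0 < δ → δ < 1 →
      ∀ k : ℕ, k ∈ (LazyRIP.lazyProgram Φ m δ).val ↔
        k ≤ N ∧ LazyRIP.LazyCertifies (Φ.map fun a => (a : ℂ)) m δ k) ∧
    -- analysis on random sign matrices
    (∃ c C : ℝ, 0 < c ∧ 0 < C ∧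
      -- `c` and `C` are constants for which random sign matrices have the RIP
      (∀ (Ω : Type*) [MeasurableSpace Ω] (μ : MeasureTheory.Measure Ω)
        [MeasureTheory.IsProbabilityMeasure μ] (n N m : ℕ) (ε : ℝ)
        (A : Ω → Matrix (Fin n) (Fin N) ℝ), LazyRIP.IsSymmetricBernoulli μ A →
        1 ≤ m → m ≤ N → 0 < ε → ε < 1 →
        C * ε⁻¹ ^ 2 * m * Real.log (Real.exp 1 * N / m) ≤ n →
        1 - 2 * Real.exp (-(c * ε ^ 2 * n)) ≤
          μ.real {ω | LazyRIP.HasRIP (LazyRIP.normalized (A ω)) m ε}) ∧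
      (∀ (Ω : Type*) [MeasurableSpace Ω] (μ : MeasureTheory.Measure Ω)
        [MeasureTheory.IsProbabilityMeasure μ] (n N m : ℕ) (δ : ℝ)
        (A : Ω → Matrix (Fin n) (Fin N) ℝ), LazyRIP.IsSymmetricBernoulli μ A →
        2 ≤ m → m ≤ N → 0 < δ → δ < 1 →
        1 - 2 * (Real.exp 1 * N / m) ^ (-(c * C * m)) ≤
          μ.real {ω | ∀ k : ℕ, m ≤ k →
            (k : ℝ) ≤ δ * Real.sqrt (m * n / (C * Real.log (Real.exp 1 * N / m))) →
            LazyRIP.LazyCertifies (LazyRIP.normalized (A ω)) m δ k})) ∧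
    -- the choice `m = (log N)³`
    (∃ K κ L : ℝ, 0 < K ∧ 0 < κ ∧ 0 < L ∧
      (∀ (n N m : ℕ) (δ : ℝ) (Φ : Matrix (Fin n) (Fin N) ℝ),
        n ≤ N → m = ⌊Real.log N ^ 3⌋₊ → 2 ≤ m → m ≤ N → 0 < δ → δ < 1 →
        ((LazyRIP.lazyProgram Φ m δ).time : ℝ) ≤ 2 ^ (L * Real.log N ^ 4)) ∧
      (∀ (Ω : Type*) [MeasurableSpace Ω] (μ : MeasureTheory.Measure Ω)
        [MeasureTheory.IsProbabilityMeasure μ] (n N m : ℕ) (δ : ℝ)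
        (A : Ω → Matrix (Fin n) (Fin N) ℝ), LazyRIP.IsSymmetricBernoulli μ A →
        m = ⌊Real.log N ^ 3⌋₊ → 2 ≤ m → m ≤ N → 0 < δ → δ < 1 →
        1 - 2 ^ (-(κ * Real.log N ^ 4)) ≤
          μ.real {ω | ∀ k : ℕ, m ≤ k →
            (k : ℝ) ≤ K * δ * Real.log N * Real.sqrt n →
            LazyRIP.LazyCertifies (LazyRIP.normalized (A ω)) m δ k})) := by
  refine ⟨?_, ?_, ⟨1 / 2 ^ 20, 2 ^ 24, by norm_num, by norm_num, ?_, ?_⟩,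
    ⟨1 / 2 ^ 13, 1 / 2, 14, by norm_num, by norm_num, by norm_num, ?_, ?_⟩⟩
  · intro n N m k δ Φ hm hmN _ _ hΦ h
    exact LazyRIP.hasRIP_of_lazyCertifies hm hmN hΦ h
  · intro n N m δ Φ hm hmN hδ _ k
    exact LazyRIP.mem_lazyProgram_iff hm hmN hδ
  · intro Ω _ μ _ n N m ε A hA hm hmN hε hε1 hn
    exact LazyRIP.measureReal_hasRIP_ge hA hm hmN hε hε1.le hn
  · intro Ω _ μ _ n N m δ A hA hm hmN hδ hδ1
    have h := LazyRIP.measureReal_lazyCertifies_ge hA hm hmN hδ hδ1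
    -- The exponent 16 is the product cC of the constants of the RIP bound.
    rwa [show (16 : ℝ) = 1 / 2 ^ 20 * 2 ^ 24 by norm_num] at h
  · intro n N m δ Φ hn hmdef hm hmN _ _
    exact LazyRIP.lazyProgram_time_le_rpow Φ δ hn hmdef hm hmN
  · intro Ω _ μ _ n N m δ A hA hmdef hm hmN hδ hδ1
    exact LazyRIP.measureReal_lazyCertifies_log_cube_ge hA hmdef hm hmN hδ hδ1
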